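/- **Theorem 3.7 (Borel–de Siebenthal algorithm).** Let $\mathfrak g$ be a finite-dimensional complex simple Lie algebra, $\mathfrak h$ a Cartan subalgebra, $\Delta\subset\mathfrak h^*$ the set of roots, $\Pi=\{\alpha_1,\dots,\alpha_\ell\}$ a base of $\Delta$ (a set of simple roots), $\Delta_+$ the corresponding positive roots, $\mathfrak b=\mathfrak h+\sum_{\varphi\in\Delta_+}\mathfrak g_\varphi$ the corresponding Borel subalgebra, and $\psi=\sum_i n_i(\psi)\alpha_i$ the highest root. Let $x_1,\dots,x_\ell\in\mathfrak h$ be the basis with $\langle\alpha_i,x_j\rangle=\delta_{ij}$. For $j\in\{1,\dots,\ell\}$ let $v_j=x_j/n_j(\psi)$ (a vertex of the fundamental alcove) and $a_j=\exp(2\pi i\,v_j)$, an element of the simply connected complex Lie group with Lie algebra $\mathfrak g$. It acts on $\mathfrak g$ by $\mathrm{Ad}\,a_j=e^{\mathrm{ad}(2\pi i\,v_j)}$; let $\mathfrak g^{a_j}=\{z\in\mathfrak g\mid \mathrm{Ad}\,a_j(z)=z\}$ be its centralizer. Put $\mathfrak m[j]=\{z\in\mathfrak g\mid[x_j,z]=0\}$,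 $\mathfrak m[j]_+=\mathfrak m[j]\cap\mathfrak b$ and $\mathfrak g_{-n_j(\psi)\beta[j]}=\{z\in\mathfrak g\mid[x_j,z]=-n_j(\psi)z\}$. The extended Dynkin diagram of $\mathfrak g$ is the Dynkin diagram of $\mathfrak g$ with respect to $\Pi$ together with one additional node $\alpha_0$, which is linked to $\alpha_i$ by $m_i=2(\alpha_i,\psi)/(\alpha_i,\alpha_i)$ lines, with an arrowhead directed at $\alpha_i$ if $m_i>1$. Then $\mathfrak g^{a_j}$ is semisimple, $\mathfrak h\subset\mathfrak g^{a_j}$ is a Cartan subalgebra of $\mathfrak g^{a_j}$, the subspace $$\mathfrak b[j]=\mathfrak m[j]_++\mathfrak g_{-n_j(\psi)\beta[j]}$$ is a Borel subalgebra of $\mathfrak g^{a_j}$, and the simple roots of $(\mathfrak g^{a_j},\mathfrak h)$ for the system of positive roots defined by $\mathfrak b[j]$ are exactly $(\Pi\setminus\{\alpha_j\})\cup\{-\psi\}$. The Dynkin diagram of $\mathfrak g^{a_j}$ with respect to these simple roots is, when $-\psi$ is identified with $\alpha_0$, the diagram that remains after deleting from the extended Dynkin diagram of $\mathfrak g$ the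 node $\alpha_j$ and all lines linked to it. -/

import Mathlib

namespace BorelDeSiebenthal

noncomputable section

/-! ### The exponential of an endomorphism -/

section Exponential

variable {V W : Type*} [AddCommGroup V] [Module ℂ V] [FiniteDimensional ℂ V]
  [AddCommGroup W] [Module ℂ W] [FiniteDimensional ℂ W]

/-- The exponential `e ^ T = ∑ Tⁿ / n!` of an endomorphism of a finite-dimensional complex vector
space (computed as a matrix exponential in a basis; the result does not depend on the basis). -/
def expEnd (T : Module.End ℂ V) : Module.End ℂ V :=
  (LinearMap.toMatrixAlgEquiv (Module.finBasis ℂ V)).symm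
    (NormedSpace.exp (LinearMap.toMatrixAlgEquiv (Module.finBasis ℂ V) T))

open scoped Matrix.Norms.Operator in
theorem hasSum_matrix_exp_aux {n : Type*} [Fintype n] [DecidableEq n] (A : Matrix n n ℂ) :
    ∃ B : Matrix n n ℂ, B = NormedSpace.exp A ∧
      ∀ i j, HasSum (fun k : ℕ => ((k.factorial : ℂ)⁻¹) • (A ^ k) i j) (B i j) := by
  refine ⟨_, rfl, fun i j => ?_⟩
  have h := NormedSpace.exp_series_hasSum_exp' (𝕂 := ℂ) A
  have hc : Continuous (Matrix.entryLinearMap ℂ ℂ i j : Matrix n n ℂ →ₗ[ℂ] ℂ) :=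
    LinearMap.continuous_of_finiteDimensional _
  exact h.map (Matrix.entryLinearMap ℂ ℂ i j) hc

theorem hasSum_matrix_exp {n : Type*} [Fintype n] [DecidableEq n] (A : Matrix n n ℂ) :
    HasSum (fun k : ℕ => ((k.factorial : ℂ)⁻¹) • A ^ k) (NormedSpace.exp A) := by
  obtain ⟨B, hB, h⟩ := hasSum_matrix_exp_aux A
  rw [← hB]
  exact Pi.hasSum.2 fun i => Pi.hasSum.2 fun j => h i j

theorem expEnd_intertwine (f : V →ₗ[ℂ] W) (S : Module.End ℂ V) (T : Module.End ℂ W)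
    (h : f ∘ₗ S = T ∘ₗ f) : f ∘ₗ expEnd S = expEnd T ∘ₗ f := by
  have hpow : ∀ k : ℕ, f ∘ₗ (S ^ k) = (T ^ k) ∘ₗ f := by
    intro k
    induction k with
    | zero => rfl
    | succ k ih =>
      ext v
      have h1 := LinearMap.congr_fun ih (S v)
      have h2 := LinearMap.congr_fun h v
      simp only [LinearMap.comp_apply] at h1 h2
      simp only [LinearMap.comp_apply, pow_succ, Module.End.mul_apply, h1, h2]
  ext v
  let eV := LinearMap.toMatrixAlgEquiv (Module.finBasis ℂ V)
  let eW := LinearMap.toMatrixAlgEquiv (Module.finBasis ℂ W)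
  let bW := Module.finBasis ℂ W
  apply bW.equivFun.injective
  let F : Matrix _ _ ℂ →ₗ[ℂ] (Fin (Module.finrank ℂ W) → ℂ) :=
    bW.equivFun.toLinearMap ∘ₗ f ∘ₗ (LinearMap.applyₗ v) ∘ₗ eV.symm.toLinearMap
  let G : Matrix _ _ ℂ →ₗ[ℂ] (Fin (Module.finrank ℂ W) → ℂ) :=
    bW.equivFun.toLinearMap ∘ₗ (LinearMap.applyₗ (f v)) ∘ₗ eW.symm.toLinearMap
  have h1 := (hasSum_matrix_exp (eV S)).map F (LinearMap.continuous_of_finiteDimensional F)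
  have h2 := (hasSum_matrix_exp (eW T)).map G (LinearMap.continuous_of_finiteDimensional G)
  suffices hFG : F (NormedSpace.exp (eV S)) = G (NormedSpace.exp (eW T)) from hFG
  refine h1.unique ?_
  convert h2 using 1
  funext k
  have := LinearMap.congr_fun (hpow k) v
  simp only [LinearMap.comp_apply] at this
  simp [F, G, ← map_pow, this]

theorem expEnd_map (F : Module.End ℂ V →ₐ[ℂ] Module.End ℂ W) (T : Module.End ℂ V) :
    F (expEnd T) = expEnd (F T) := by
  let eV := LinearMap.toMatrixAlgEquiv (Module.finBasis ℂ V)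
  let eW := LinearMap.toMatrixAlgEquiv (Module.finBasis ℂ W)
  let G : Matrix _ _ ℂ →ₗ[ℂ] Matrix _ _ ℂ :=
    eW.toLinearMap ∘ₗ F.toLinearMap ∘ₗ eV.symm.toLinearMap
  have h1 := (hasSum_matrix_exp (eV T)).map G (LinearMap.continuous_of_finiteDimensional G)
  have h2 := hasSum_matrix_exp (eW (F T))
  apply eW.injective
  refine (h1.unique ?_).trans (eW.apply_symm_apply _).symm
  convert h2 using 1
  funext k
  simp [G, ← map_pow]

theorem expEnd_add_of_commute (S T : Module.End ℂ V) (h : Commute S T) :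
    expEnd (S + T) = expEnd S * expEnd T := by
  rw [expEnd, expEnd, expEnd, map_add, Matrix.exp_add_of_commute _ _ (h.map _), map_mul]

theorem expEnd_zero : expEnd (0 : Module.End ℂ V) = 1 := by
  rw [expEnd, map_zero, NormedSpace.exp_zero, map_one]

/-- On an eigenvector of `T` with eigenvalue `μ`, the operator `e ^ T` acts by `e ^ μ`. -/
theorem expEnd_apply_of_eigenvector (T : Module.End ℂ V) (μ : ℂ) (v : V) (h : T v = μ • v) :
    expEnd T v = Complex.exp μ • v := by
  let eV := LinearMap.toMatrixAlgEquiv (Module.finBasis ℂ V)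
  let bV := Module.finBasis ℂ V
  have hpow : ∀ k : ℕ, (T ^ k) v = μ ^ k • v := by
    intro k
    induction k with
    | zero => simp
    | succ k ih => rw [pow_succ', Module.End.mul_apply, ih, map_smul, h, smul_smul, pow_succ]
  apply bV.equivFun.injective
  let F : Matrix _ _ ℂ →ₗ[ℂ] (Fin (Module.finrank ℂ V) → ℂ) :=
    bV.equivFun.toLinearMap ∘ₗ (LinearMap.applyₗ v) ∘ₗ eV.symm.toLinearMap
  have h1 := (hasSum_matrix_exp (eV T)).map F (LinearMap.continuous_of_finiteDimensional F)
  refine h1.unique ?_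
  rw [map_smul, Complex.exp_eq_exp_ℂ]
  have h2 := (NormedSpace.exp_series_hasSum_exp' (𝕂 := ℂ) μ).smul_const (bV.equivFun v)
  convert h2 using 1
  funext k
  simp [F, ← map_pow, hpow, smul_smul]

end Exponential

/-! ### The adjoint action of `exp x` and its fixed subalgebra -/

section AdExp

variable {𝔤 : Type*} [LieRing 𝔤] [LieAlgebra ℂ 𝔤] [FiniteDimensional ℂ 𝔤]

open scoped TensorProduct in
theorem expEnd_ad_lie (x y z : 𝔤) :
    expEnd (LieAlgebra.ad ℂ 𝔤 x) ⁅y, z⁆ =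
      ⁅expEnd (LieAlgebra.ad ℂ 𝔤 x) y, expEnd (LieAlgebra.ad ℂ 𝔤 x) z⁆ := by
  set D : Module.End ℂ 𝔤 := LieAlgebra.ad ℂ 𝔤 x with hD
  let μ : 𝔤 ⊗[ℂ] 𝔤 →ₗ[ℂ] 𝔤 := TensorProduct.lift (LieModule.toEnd ℂ 𝔤 𝔤 : 𝔤 →ₗ[ℂ] Module.End ℂ 𝔤)
  let L : Module.End ℂ (𝔤 ⊗[ℂ] 𝔤) := LinearMap.rTensor 𝔤 D
  let R : Module.End ℂ (𝔤 ⊗[ℂ] 𝔤) := LinearMap.lTensor 𝔤 D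
  have hc : Commute L R := by
    refine TensorProduct.ext' fun a c => ?_
    simp [L, R]
  have hi : μ ∘ₗ (L + R) = D ∘ₗ μ := by
    refine TensorProduct.ext' fun a c => ?_
    simp [L, R, μ, hD]
  have h := expEnd_intertwine μ (L + R) D hi
  rw [expEnd_add_of_commute L R hc] at h
  have hL : expEnd L = LinearMap.rTensor 𝔤 (expEnd D) :=
    (expEnd_map (Module.End.rTensorAlgHom ℂ 𝔤 𝔤) D).symm
  have hR : expEnd R = LinearMap.lTensor 𝔤 (expEnd D) :=
    (expEnd_map (Module.End.lTensorAlgHom ℂ 𝔤 𝔤) D).symm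
  have h' := LinearMap.congr_fun h (y ⊗ₜ z)
  rw [hL, hR] at h'
  simpa [μ] using h'.symm

/-- The automorphism `Ad (exp x) = e ^ (ad x)` of the Lie algebra `𝔤`: the adjoint action on `𝔤` of
the element `exp x` of a complex Lie group with Lie algebra `𝔤`. -/
def AdExp (x : 𝔤) : 𝔤 ≃ₗ⁅ℂ⁆ 𝔤 where
  toFun := expEnd (LieAlgebra.ad ℂ 𝔤 x)
  map_add' := map_add _
  map_smul' := map_smul _
  map_lie' := expEnd_ad_lie x _ _
  invFun := expEnd (-LieAlgebra.ad ℂ 𝔤 x)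
  left_inv z := by
    change (expEnd (-LieAlgebra.ad ℂ 𝔤 x) * expEnd (LieAlgebra.ad ℂ 𝔤 x)) z = z
    rw [← expEnd_add_of_commute _ _ (Commute.neg_left (Commute.refl (LieAlgebra.ad ℂ 𝔤 x))), neg_add_cancel, expEnd_zero]
    rfl
  right_inv z := by
    change (expEnd (LieAlgebra.ad ℂ 𝔤 x) * expEnd (-LieAlgebra.ad ℂ 𝔤 x)) z = z
    rw [← expEnd_add_of_commute _ _ (Commute.neg_right (Commute.refl (LieAlgebra.ad ℂ 𝔤 x))), add_neg_cancel, expEnd_zero]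
    rfl

/-- The centralizer in `𝔤` of the group element `exp x`, i.e. the Lie subalgebra
`{z ∈ 𝔤 | Ad (exp x) z = z}`. -/
def centralizerExp (x : 𝔤) : LieSubalgebra ℂ 𝔤 where
  carrier := {z | AdExp x z = z}
  add_mem' {y z} hy hz := by
    change AdExp x (y + z) = y + z
    change AdExp x y = y at hy
    change AdExp x z = z at hz
    rw [map_add, hy, hz]
  zero_mem' := map_zero _
  smul_mem' c z hz := by
    change AdExp x (c • z) = c • z
    change AdExp x z = z at hz
    rw [map_smul, hz]
  lie_mem' {y z} hy hz := by
    change AdExp x ⁅y, z⁆ = ⁅y, z⁆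
    change AdExp x y = y at hy
    change AdExp x z = z at hz
    rw [LieEquiv.map_lie, hy, hz]

end AdExp

/-! ### Dynkin diagrams -/

/-- A diagram in the style of Dynkin on the set of nodes `ι`: `lines i k` is the number of lines
that link the nodes `i` and `k`, and `arrow i k` says that the lines from `i` to `k` carry an
arrowhead that is directed at `k`. -/
structure DynkinDiagram (ι : Type*) where
  lines : ι → ι → ℕ
  arrow : ι → ι → Prop

namespace DynkinDiagram

variable {ι κ : Type*}

/-- Delete the node `j` and all lines linked to it. -/
def deleteNode (D : DynkinDiagram ι) (j : ι) : DynkinDiagram {i : ι // i ≠ j} where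
  lines i k := D.lines i k
  arrow i k := D.arrow i k

/-- An isomorphism of diagrams: a bijection of the nodes that preserves lines and arrowheads. -/
structure Iso (D : DynkinDiagram ι) (E : DynkinDiagram κ) where
  nodes : ι ≃ κ
  lines_eq : ∀ i k, E.lines (nodes i) (nodes k) = D.lines i k
  arrow_iff : ∀ i k, E.arrow (nodes i) (nodes k) ↔ D.arrow i k

end DynkinDiagram

section RootSystem

variable {ι M N : Type*} [AddCommGroup M] [Module ℂ M] [AddCommGroup N] [Module ℂ N]
  {P : RootPairing ι ℂ M N}

/-- The Dynkin diagram of a root system with respect to a base. The nodes are the simple roots.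
Distinct simple roots `α`, `β` are linked by `⟨α, β^∨⟩ ⟨β, α^∨⟩` lines, with an arrowhead directed
at the shorter root if their lengths differ. (Here `⟨α, β^∨⟩ = 2 (α, β) / (β, β)`, so for linked
roots `β` is the shorter one exactly when `|⟨β, α^∨⟩| < |⟨α, β^∨⟩|`.) -/
def dynkinDiagram [P.IsCrystallographic] (b : P.Base) : DynkinDiagram b.support where
  lines i k := open scoped Classical in
    if i = k then 0 else (P.pairingIn ℤ i k * P.pairingIn ℤ k i).toNat
  arrow i k := |P.pairingIn ℤ k i| < |P.pairingIn ℤ i k|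

/-- `ψ` is the highest root: `ψ - φ` is a sum of simple roots for every root `φ`. -/
def IsHighestRoot (b : P.Base) (ψ : ι) : Prop :=
  ∀ φ : ι, P.root ψ - P.root φ ∈ AddSubmonoid.closure (P.root '' b.support)

/-- The extended Dynkin diagram: the Dynkin diagram together with an additional node `α₀`
(here `none`), which is linked to the simple root `αᵢ` by
`mᵢ = 2 (αᵢ, ψ) / (αᵢ, αᵢ) = ⟨ψ, αᵢ^∨⟩` lines, with an arrowhead directed at `αᵢ` if `mᵢ > 1`. -/
def extendedDynkinDiagram [P.IsCrystallographic] (b : P.Base) (ψ : ι) :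
    DynkinDiagram (Option b.support) where
  lines
    | some i, some k => (dynkinDiagram b).lines i k
    | none, some i => (P.pairingIn ℤ ψ i).toNat
    | some i, none => (P.pairingIn ℤ ψ i).toNat
    | none, none => 0
  arrow
    | some i, some k => (dynkinDiagram b).arrow i k
    | none, some i => 1 < P.pairingIn ℤ ψ i
    | some _, none => False
    | none, none => False

/-- The root attached to a node of the extended Dynkin diagram: `αᵢ` to the node `αᵢ`, and `-ψ` to
the additional node. -/
def nodeRoot (b : P.Base) (ψ : ι) : Option b.support → M
  | some i => P.root i
  | none => -P.root ψ

variable [P.IsRootSystem]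

/-- The coefficient `n_j(φ)` of the root `φ` at the simple root `α_j`. -/
def coeff (b : P.Base) (φ : ι) (j : b.support) : ℂ :=
  b.toWeightBasis.repr (P.root φ) j

end RootSystem

/-! ### Subalgebras attached to a Cartan subalgebra and a base -/

section Subalgebras

open LieAlgebra LieAlgebra.IsKilling

/-- A Borel subalgebra: a maximal solvable subalgebra. -/
def IsBorel {L : Type*} [LieRing L] [LieAlgebra ℂ L] (B : LieSubalgebra ℂ L) : Prop :=
  Maximal (fun C : LieSubalgebra ℂ L => LieAlgebra.IsSolvable C) B

variable {𝔤 : Type*} [LieRing 𝔤] [LieAlgebra ℂ 𝔤] [FiniteDimensional ℂ 𝔤] [IsKilling ℂ 𝔤]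
  {H : LieSubalgebra ℂ 𝔤} [H.IsCartanSubalgebra]

/-- The element `x_j` of the Cartan subalgebra: the basis `(x_j)` is dual to the basis of simple
roots. -/
def fundCoweight (b : (rootSystem H).Base) (j : b.support) : H :=
  (Module.evalEquiv ℂ H).symm (b.toWeightBasis.coord j)

open scoped Classical in
theorem simpleRoot_fundCoweight (b : (rootSystem H).Base) (i j : b.support) :
    (rootSystem H).root i (fundCoweight b j) = if i = j then 1 else 0 := by
  have h : ∀ f : Module.Dual ℂ H, f (fundCoweight b j) = b.toWeightBasis.coord j f := fun f => by
    rw [fundCoweight, Module.apply_evalEquiv_symm_apply]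
  rw [h, Module.Basis.coord_apply, RootPairing.Base.toWeightBasis_repr_root,
    Finsupp.single_apply]

/-- The vertex `v_j = x_j / n_j(ψ)` of the fundamental alcove. -/
def alcoveVertex (b : (rootSystem H).Base) (ψ : H.root) (j : b.support) : H :=
  (coeff b ψ j)⁻¹ • fundCoweight b j

/-- `𝔤^{a_j}`, the centralizer in `𝔤` of `a_j = exp (2πi v_j)`. -/
def vertexCentralizer (b : (rootSystem H).Base) (ψ : H.root) (j : b.support) :
    LieSubalgebra ℂ 𝔤 :=
  centralizerExp ((2 * Real.pi * Complex.I) • (alcoveVertex b ψ j : 𝔤))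

/-- The standard Borel subalgebra `𝔟`: the sum of `H` and the root spaces of positive roots. -/
def standardBorel (b : (rootSystem H).Base) : Submodule ℂ 𝔤 :=
  H.toSubmodule ⊔ ⨆ (φ : H.root) (_ : b.IsPos φ), (rootSpace H φ.1).toSubmodule

/-- The space `𝔤_{kβ[j]} = {z | [x_j, z] = k z}`. For `k = 0` it is `𝔪[j]`, the centralizer of
`x_j`. -/
def gradedPart (b : (rootSystem H).Base) (j : b.support) (k : ℂ) : Submodule ℂ 𝔤 :=
  Module.End.eigenspace (ad ℂ 𝔤 (fundCoweight b j : 𝔤)) k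

/-- `𝔟[j] = (𝔪[j] ∩ 𝔟) + 𝔤_{-n_j(ψ)β[j]}`. -/
def vertexBorel (b : (rootSystem H).Base) (ψ : H.root) (j : b.support) : Submodule ℂ 𝔤 :=
  (gradedPart b j 0 ⊓ standardBorel b) ⊔ gradedPart b j (-coeff b ψ j)

end Subalgebras

end

end BorelDeSiebenthal

/-! Write `n_j(φ)` for the `α_j`-coefficient of `φ`. On the root space of `φ`, `Ad a_j` is the
scalar `exp (2πi n_j(φ) / n_j(ψ))`. Since `ψ` is highest, `|n_j(φ)| ≤ n_j(ψ)`, so this scalar is `1`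
exactly when `n_j(φ)` is `0` or `±n_j(ψ)` (`mem_vertexCentralizer_iff_of_mem_rootSpace`). These
roots form a symmetric set that contains `ψ` and every `α_i` with `i ≠ j`, and so spans the dual of
`H`; hence the centralizer is semisimple (`isKilling_of_forall_root`).

If `n_j(φ) = 0`, then `φ` or `-φ` is a sum of simple roots other than `α_j`. If `n_j(φ) = -n_j(ψ)`,
then `φ = (ψ + φ) + (-ψ)`, where `ψ + φ` is such a sum. So the simple roots other than `α_j`,
together with `-ψ`, form a base (`exists_base_vertexCentralizer`). Its positive roots are the
positive `φ` with `n_j(φ) = 0` and all `φ` with `n_j(φ) = -n_j(ψ)`, which are the roots of `𝔟[j]`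
(`map_standardBorel_eq_vertexBorel`). That the standard subalgebra of a base is Borel is proved for
every Killing Lie algebra in `isBorel_standardBorelSubalgebra`.

Coroots computed in the centralizer and in `𝔤` agree (`comapInclEquiv_coroot`), so the Dynkin
diagram can be read off in `𝔤`. For `i ≠ j` the integers `⟨ψ, α_i^∨⟩` and `⟨α_i, ψ^∨⟩` are both `0`,
or the first is positive and the second is `1` (`IsHighestRoot.pairingIn_eq_or`); this gives the
edges at the extra node. -/

namespace RootPairing.Base

/-! ### Coordinates with respect to a base -/

variable {ι R M N : Type*} [CommRing R] [CharZero R] [AddCommGroup M] [Module R M]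
  [AddCommGroup N] [Module R N] {P : RootPairing ι R M N}

section

variable [P.IsRootSystem] (b : P.Base)

lemma exists_repr_eq_natCast_of_mem_closure {x : M}
    (hx : x ∈ AddSubmonoid.closure (P.root '' b.support)) (i : b.support) :
    ∃ n : ℕ, b.toWeightBasis.repr x i = n := by
  classical
  induction hx using AddSubmonoid.closure_induction with
  | mem x hx =>
    obtain ⟨k, hk, rfl⟩ := hx
    refine ⟨if k = i then 1 else 0, ?_⟩
    have := b.toWeightBasis_repr_root ⟨k, hk⟩
    rw [this, Finsupp.single_apply]
    simp [Subtype.ext_iff]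
  | zero => exact ⟨0, by simp⟩
  | add x y _ _ hx hy =>
    obtain ⟨m, hm⟩ := hx
    obtain ⟨n, hn⟩ := hy
    exact ⟨m + n, by simp [hm, hn]⟩

lemma exists_repr_root_eq_intCast (φ : ι) (i : b.support) :
    ∃ n : ℤ, b.toWeightBasis.repr (P.root φ) i = n := by
  rcases b.root_mem_or_neg_mem φ with h | h
  · obtain ⟨n, hn⟩ := b.exists_repr_eq_natCast_of_mem_closure h i
    exact ⟨n, by simp [hn]⟩
  · obtain ⟨n, hn⟩ := b.exists_repr_eq_natCast_of_mem_closure h i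
    refine ⟨-n, ?_⟩
    rw [map_neg, Finsupp.neg_apply] at hn
    rw [← neg_neg (b.toWeightBasis.repr _ _), hn]
    simp

lemma mem_closure_of_forall_repr {x : M} {T : Set M}
    (hx : x ∈ AddSubmonoid.closure (P.root '' b.support))
    (hT : ∀ i : b.support, b.toWeightBasis.repr x i = 0 ∨ P.root i ∈ T) :
    x ∈ AddSubmonoid.closure T := by
  rw [← b.toWeightBasis.sum_repr x]
  refine AddSubmonoid.sum_mem _ fun i _ ↦ ?_
  rcases hT i with h | h
  · simp [h]
  · obtain ⟨n, hn⟩ := b.exists_repr_eq_natCast_of_mem_closure hx i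
    rw [hn, toWeightBasis_apply, Nat.cast_smul_eq_nsmul]
    exact AddSubmonoid.nsmul_mem _ (AddSubmonoid.subset_closure h) n

lemma cast_height_eq_sum_repr (φ : ι) :
    (b.height φ : R) = ∑ i, b.toWeightBasis.repr (P.root φ) i := by
  choose f hf using b.exists_repr_root_eq_intCast φ
  classical
  -- `height_eq_sum` takes coefficients on the whole index type, so they are extended by zero off
  -- the support.
  let g : ι → ℤ := fun i ↦ if hi : i ∈ b.support then f ⟨i, hi⟩ else 0
  have hg (i : b.support) : f i = g i := by simp [g]
  have h : P.root φ = ∑ i ∈ b.support, g i • P.root i := by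
    rw [← Finset.sum_coe_sort b.support fun i ↦ g i • P.root i]
    conv_lhs => rw [← b.toWeightBasis.sum_repr (P.root φ)]
    refine Finset.sum_congr rfl fun i _ ↦ ?_
    rw [hf, hg, toWeightBasis_apply, Int.cast_smul_eq_zsmul]
  rw [height_eq_sum h, ← Finset.sum_coe_sort b.support g]
  simp [hf, hg]

/-- `IsPos` is the sign of the height, and a sum of simple roots has nonnegative height. Conversely,
if `-φ` were the sum of simple roots, then `φ` and `-φ` would both be positive. -/
lemma isPos_iff_mem_closure (φ : ι) :
    b.IsPos φ ↔ P.root φ ∈ AddSubmonoid.closure (P.root '' b.support) := by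
  have key (φ : ι) (h : P.root φ ∈ AddSubmonoid.closure (P.root '' b.support)) : b.IsPos φ := by
    choose f hf using b.exists_repr_eq_natCast_of_mem_closure h
    rw [isPos_iff']
    have : (b.height φ : R) = ((∑ i, f i : ℕ) : ℤ) := by
      rw [cast_height_eq_sum_repr]
      simp [hf]
    rw [Int.cast_injective this]
    positivity
  refine ⟨fun h ↦ ?_, key φ⟩
  refine (b.root_mem_or_neg_mem φ).resolve_right fun h' ↦ ?_
  let := P.indexNeg
  exact (IsPos.neg_iff_not b φ).mp (key (-φ) (by simpa using h')) h

end

/-- `Base.mk'` needs only conditions on roots. The equivalence keeps the labels `ν`, which later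
become the nodes of the diagram. -/
lemma exists_of_linearIndependent_of_mem_or_neg_mem {ι R M N ν : Type*} [Finite ι] [Field R]
    [CharZero R] [AddCommGroup M] [Module R M] [AddCommGroup N] [Module R N]
    (P : RootPairing ι R M N) [P.IsRootSystem] [P.IsCrystallographic] [P.IsReduced]
    (f : ν → ι) (hli : LinearIndependent R (P.root ∘ f))
    (hsp : ∀ i, P.root i ∈ AddSubmonoid.closure (Set.range (P.root ∘ f)) ∨
      -P.root i ∈ AddSubmonoid.closure (Set.range (P.root ∘ f))) :
    ∃ (b : P.Base) (e : b.support ≃ ν), ∀ i : b.support, f (e i) = i := by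
  have hf : Function.Injective f := hli.injective.of_comp
  have hr : P.root '' Set.range f = Set.range (P.root ∘ f) := (Set.range_comp _ _).symm
  let b : P.Base := Base.mk' P (Set.range f) ((linearIndepOn_range_iff hf _).mpr hli)
    (by simpa [hr] using hsp)
  have hb (i : ι) : i ∈ b.support ↔ i ∈ Set.range f := by simp [b, Base.mk']
  let e := (Equiv.subtypeEquivRight hb).trans (Equiv.ofInjective f hf).symm
  exact ⟨b, e, fun i ↦ Equiv.apply_ofInjective_symm hf _⟩

end RootPairing.Base

/-! ### Weight vectors, root spaces and solvability -/

/-- Each of `h`, `e`, `f` is a multiple of a bracket of two of them, so all three survive in every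
term of the derived series. -/
lemma IsSl2Triple.not_isSolvable {K L : Type*} [Field K] [CharZero K] [LieRing L] [LieAlgebra K L]
    {h e f : L} (t : IsSl2Triple h e f) : ¬ LieAlgebra.IsSolvable L := by
  intro hs
  obtain ⟨k, hk⟩ := (LieAlgebra.isSolvable_iff K L).mp hs
  have key (k : ℕ) : h ∈ LieAlgebra.derivedSeries K L k ∧ e ∈ LieAlgebra.derivedSeries K L k ∧
      f ∈ LieAlgebra.derivedSeries K L k := by
    induction k with
    | zero => simp [LieAlgebra.derivedSeries_def]
    | succ k ih =>
      obtain ⟨hh, he, hf⟩ := ih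
      rw [LieAlgebra.derivedSeries_def, LieAlgebra.derivedSeriesOfIdeal_succ,
        ← LieAlgebra.derivedSeries_def]
      refine ⟨?_, ?_, ?_⟩
      · rw [← t.lie_e_f]
        exact LieSubmodule.lie_mem_lie he hf
      · have : e = (2 : K)⁻¹ • ⁅h, e⁆ := by rw [t.lie_h_e_smul K, smul_smul]; simp
        rw [this]
        exact SMulMemClass.smul_mem _ (LieSubmodule.lie_mem_lie hh he)
      · have : f = (-(2 : K)⁻¹) • ⁅h, f⁆ := by
          rw [t.lie_lie_smul_f K, neg_smul, smul_neg, neg_neg, smul_smul]; simp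
        rw [this]
        exact SMulMemClass.smul_mem _ (LieSubmodule.lie_mem_lie hh hf)
  have := (key k).1
  rw [hk, LieSubmodule.mem_bot] at this
  exact t.h_ne_zero this

namespace LieAlgebra.IsKilling

open LieModule

variable {L : Type*} [LieRing L] [LieAlgebra ℂ L] [FiniteDimensional ℂ L] 
  {H : LieSubalgebra ℂ L} [H.IsCartanSubalgebra]

lemma mem_rootSpace_zero_iff {x : L} : x ∈ rootSpace H (0 : H → ℂ) ↔ x ∈ H := by
  simp

lemma eq_zero_or_root_of_mem_rootSpace {χ : H → ℂ} {x : L} (hx : x ∈ rootSpace H χ) (hx0 : x ≠ 0) :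
    χ = 0 ∨ ∃ α : H.root, χ = α.1 := by
  by_cases hχ : χ = 0
  · exact Or.inl hχ
  · have hb : genWeightSpace L χ ≠ ⊥ := fun h ↦ hx0 (by simpa [h] using hx)
    exact Or.inr ⟨⟨⟨χ, hb⟩, Finset.mem_filter.mpr ⟨Finset.mem_univ _, hχ⟩⟩, rfl⟩

/-- A subspace that is stable under a Cartan subalgebra is spanned by its weight vectors. -/
lemma le_of_forall_mem_rootSpace {N M : Submodule ℂ L}
    (hN : ∀ h ∈ H, ∀ x ∈ N, ⁅h, x⁆ ∈ N) (h0 : ∀ x ∈ N, x ∈ H → x ∈ M)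
    (hM : ∀ α : H.root, ∀ x ∈ N, x ∈ rootSpace H α.1 → x ∈ M) : N ≤ M := by
  let N' : LieSubmodule ℂ H L := { N with lie_mem := fun {h x} hx ↦ hN h h.2 x hx }
  have h := eq_iSup_inf_genWeightSpace (K := ℂ) (L := H) (M := L) N'
  have hle : N'.toSubmodule ≤ M := by
    rw [h, LieSubmodule.iSup_toSubmodule]
    refine iSup_le fun χ x hx ↦ ?_
    obtain ⟨hx₁, hx₂⟩ := hx
    by_cases hχ : χ.IsZero
    · refine h0 x hx₁ (mem_rootSpace_zero_iff.mp ?_)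
      rw [hχ.eq] at hx₂
      exact hx₂
    · exact hM ⟨χ, by simpa [LieSubalgebra.root] using hχ⟩ x hx₁ hx₂
  exact hle

variable [IsKilling ℂ L]

/-- Root spaces are defined by generalized eigenvectors; in a Killing Lie algebra `H` acts
diagonalizably, so these are true eigenvectors. -/
lemma mem_rootSpace_iff {χ : H → ℂ} {x : L} :
    x ∈ rootSpace H χ ↔ ∀ h : H, ⁅(h : L), x⁆ = χ h • x :=
  ⟨fun hx h ↦ lie_eq_smul_of_mem_rootSpace hx h,
    fun hx ↦ weightSpace_le_genWeightSpace L χ ((mem_weightSpace χ x).mpr hx)⟩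

/-- Root spaces are one-dimensional, so one nonzero vector decides containment. -/
lemma rootSpace_le_of_mem {α : H.root} {N : Submodule ℂ L} {x : L} (hx : x ∈ rootSpace H α.1)
    (hx0 : x ≠ 0) (hxN : x ∈ N) : (rootSpace H α.1).toSubmodule ≤ N := by
  intro y hy
  obtain ⟨c, hc⟩ := (finrank_eq_one_iff_of_nonzero' (⟨x, hx⟩ : rootSpace H α.1)
    (by simpa using hx0)).mp (finrank_rootSpace_eq_one α.1 (H.isNonZero_coe_root α)) ⟨y, hy⟩
  have hc' : c • x = y := congrArg Subtype.val hc
  exact hc' ▸ N.smul_mem c hxN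

lemma not_isSolvable_of_rootSpace_le {C : LieSubalgebra ℂ L} {α : H.root}
    (h₁ : (rootSpace H α.1).toSubmodule ≤ C.toSubmodule)
    (h₂ : (rootSpace H (-α.1 : H → ℂ)).toSubmodule ≤ C.toSubmodule) : ¬ IsSolvable C := by
  obtain ⟨h, e, f, t, he, hf⟩ := exists_isSl2Triple_of_weight_isNonZero (H.isNonZero_coe_root α)
  have he' : e ∈ C := h₁ he
  have hf' : f ∈ C := h₂ hf
  have hh' : h ∈ C := t.lie_e_f ▸ C.lie_mem he' hf'
  have t' : IsSl2Triple (⟨h, hh'⟩ : C) ⟨e, he'⟩ ⟨f, hf'⟩ :=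
    ⟨fun h0 ↦ t.h_ne_zero (congrArg Subtype.val h0), Subtype.ext t.lie_e_f,
      Subtype.ext t.lie_h_e_nsmul, Subtype.ext t.lie_h_f_nsmul⟩
  exact t'.not_isSolvable (K := ℂ)

lemma neg_coe_root (α : H.root) :
    ((((rootSystem H).reflectionPerm α α).1 : Weight ℂ H L) : H → ℂ) = -(α.1 : H → ℂ) := by
  have := (rootSystem H).root_reflectionPerm α α
  rw [RootPairing.reflection_apply_self] at this
  ext h
  exact LinearMap.congr_fun this h

/-! ### The filtration by height -/

section Height

variable (b : (rootSystem H).Base)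

/-- The element of the Cartan subalgebra on which every root takes its height as its value. -/
noncomputable def heightCoweight : H :=
  (Module.evalEquiv ℂ H).symm (∑ i, b.toWeightBasis.coord i)

lemma root_heightCoweight (α : H.root) : α.1 (heightCoweight b) = b.height α := by
  rw [b.cast_height_eq_sum_repr]
  have : (rootSystem H).root α (heightCoweight b) =
      ∑ i, b.toWeightBasis.repr ((rootSystem H).root α) i := by
    rw [heightCoweight, Module.apply_evalEquiv_symm_apply]
    simp
  exact this

/-- The sum of the weight spaces of height at least `k`. -/
noncomputable def heightFiltration (k : ℕ) : Submodule ℂ L :=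
  ⨆ χ ∈ {χ : H → ℂ | ∃ n : ℕ, χ (heightCoweight b) = n + k}, (rootSpace H χ).toSubmodule

variable {b}

lemma mem_heightFiltration_of_mem {χ : H → ℂ} {k n : ℕ} {x : L}
    (hn : χ (heightCoweight b) = n + k) (hx : x ∈ rootSpace H χ) : x ∈ heightFiltration b k :=
  Submodule.mem_iSup_of_mem χ (Submodule.mem_iSup_of_mem ⟨n, hn⟩ hx)

lemma heightFiltration_induction {k : ℕ} (p : L → Prop)
    (mem : ∀ (χ : H → ℂ) (n : ℕ), χ (heightCoweight b) = n + k → ∀ x ∈ rootSpace H χ, p x)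
    (zero : p 0) (add : ∀ x y, p x → p y → p (x + y)) {x : L} (hx : x ∈ heightFiltration b k) :
    p x := by
  refine Submodule.iSup_induction _ (motive := p) hx (fun χ y hy ↦ ?_) zero add
  refine Submodule.iSup_induction _ (motive := p) hy (fun ⟨n, hn⟩ z hz ↦ mem χ n hn z hz) zero add

/-- Weights add under the bracket. Since `χ` runs over all functions on `H`, it does not matter
whether the sum of two roots is a root. -/
lemma lie_mem_heightFiltration {k l : ℕ} {x y : L} (hx : x ∈ heightFiltration b k)
    (hy : y ∈ heightFiltration b l) : ⁅x, y⁆ ∈ heightFiltration b (k + l) := by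
  refine heightFiltration_induction (p := fun x ↦ ⁅x, y⁆ ∈ _) (fun χ₁ m hm x hx ↦ ?_) (by simp)
    (fun x₁ x₂ h₁ h₂ ↦ by rw [add_lie]; exact add_mem h₁ h₂) hx
  refine heightFiltration_induction (p := fun y ↦ ⁅x, y⁆ ∈ _) (fun χ₂ n hn y hy ↦ ?_) (by simp)
    (fun x₁ x₂ h₁ h₂ ↦ by rw [lie_add]; exact add_mem h₁ h₂) hy
  refine mem_heightFiltration_of_mem (χ := χ₁ + χ₂) (n := m + n) ?_
    (lie_mem_genWeightSpace_of_mem_genWeightSpace hx hy)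
  rw [Pi.add_apply, hm, hn]
  push_cast
  ring

lemma heightFiltration_anti {k l : ℕ} (h : k ≤ l) : heightFiltration b l ≤ heightFiltration b k := by
  intro x hx
  refine heightFiltration_induction (p := (· ∈ _)) (fun χ n hn x hx ↦ ?_) (zero_mem _)
    (fun _ _ ↦ add_mem) hx
  refine mem_heightFiltration_of_mem (n := n + (l - k)) ?_ hx
  rw [hn]
  push_cast [Nat.cast_sub h]
  ring

/-- No root has height zero, so the part of height zero is `H` alone, and `H` is abelian. This is
what starts the descent of the derived series. -/
lemma lie_mem_heightFiltration_one {x y : L} (hx : x ∈ heightFiltration b 0)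
    (hy : y ∈ heightFiltration b 0) : ⁅x, y⁆ ∈ heightFiltration b 1 := by
  have key (χ : H → ℂ) (n : ℕ) (hn : χ (heightCoweight b) = n + (0 : ℕ)) (x : L)
      (hx : x ∈ rootSpace H χ) : x ∈ H ∨ x ∈ heightFiltration b 1 := by
    rcases eq_or_ne x 0 with rfl | hx0
    · exact Or.inl H.zero_mem
    rcases eq_zero_or_root_of_mem_rootSpace hx hx0 with rfl | ⟨α, rfl⟩
    · exact Or.inl (mem_rootSpace_zero_iff.mp hx)
    · right
      have h0 : n ≠ 0 := by
        rintro rfl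
        rw [root_heightCoweight] at hn
        exact b.height_ne_zero α (by exact_mod_cast hn)
      obtain ⟨m, rfl⟩ := Nat.exists_eq_succ_of_ne_zero h0
      exact mem_heightFiltration_of_mem (n := m) (by rw [hn]; push_cast; ring) hx
  have h01 : heightFiltration b 0 ≤ H.toSubmodule ⊔ heightFiltration b 1 := by
    intro x hx
    refine heightFiltration_induction (p := (· ∈ _)) (fun χ n hn x hx ↦ ?_) (zero_mem _)
      (fun _ _ ↦ add_mem) hx
    rcases key χ n hn x hx with h | h
    · exact Submodule.mem_sup_left h
    · exact Submodule.mem_sup_right h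
  obtain ⟨u, hu, v, hv, rfl⟩ := Submodule.mem_sup.mp (h01 hx)
  obtain ⟨w, hw, z, hz, rfl⟩ := Submodule.mem_sup.mp (h01 hy)
  have hH : H.toSubmodule ≤ heightFiltration b 0 := fun t ht ↦
    mem_heightFiltration_of_mem (χ := 0) (n := 0) (by simp) (mem_rootSpace_zero_iff.mpr ht)
  have huw : ⁅u, w⁆ = 0 := congrArg Subtype.val (trivial_lie_zero H H ⟨u, hu⟩ ⟨w, hw⟩)
  rw [lie_add, add_lie, huw, zero_add]
  refine add_mem ?_ ?_
  · exact lie_mem_heightFiltration (k := 1) (l := 0) hv (hH hw)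
  · exact lie_mem_heightFiltration (k := 0) (l := 1)
      (add_mem (hH hu) (heightFiltration_anti zero_le_one hv)) hz

lemma exists_heightFiltration_eq_bot : ∃ k, heightFiltration b k = ⊥ := by
  obtain ⟨K, hK⟩ : ∃ K : ℕ, ∀ α : H.root, b.height α < K := by
    obtain ⟨K, hK⟩ := (Set.finite_range b.height).bddAbove
    refine ⟨K.toNat + 1, fun α ↦ ?_⟩
    have := hK ⟨α, rfl⟩
    omega
  refine ⟨K + 1, (Submodule.eq_bot_iff _).mpr fun x hx ↦ ?_⟩
  refine heightFiltration_induction (p := fun x ↦ x = (0 : L)) (fun χ n hn x hx ↦ ?_) rfl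
    (fun x₁ x₂ h₁ h₂ ↦ by rw [h₁, h₂, add_zero]) hx
  by_contra hx0
  rcases eq_zero_or_root_of_mem_rootSpace hx hx0 with rfl | ⟨α, rfl⟩
  · rw [Pi.zero_apply] at hn
    have : (0 : ℕ) = n + (K + 1) := by exact_mod_cast hn
    omega
  · rw [root_heightCoweight] at hn
    have : b.height α = n + (K + 1) := by exact_mod_cast hn
    have := hK α
    omega

end Height

end LieAlgebra.IsKilling

/-! ### The standard Borel subalgebra -/

namespace BorelDeSiebenthal

open LieAlgebra LieAlgebra.IsKilling LieModule

variable {L : Type*} [LieRing L] [LieAlgebra ℂ L] [FiniteDimensional ℂ L] [IsKilling ℂ L]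
  {H : LieSubalgebra ℂ L} [H.IsCartanSubalgebra] (b : (rootSystem H).Base)

lemma le_standardBorel : H.toSubmodule ≤ standardBorel b := le_sup_left

variable {b} in
lemma rootSpace_le_standardBorel {φ : H.root} (hφ : b.IsPos φ) :
    (rootSpace H φ.1).toSubmodule ≤ standardBorel b :=
  le_sup_of_le_right (le_iSup₂_of_le φ hφ le_rfl)

lemma standardBorel_eq_heightFiltration : standardBorel b = heightFiltration b 0 := by
  refine le_antisymm (sup_le (fun x hx ↦ ?_) (iSup₂_le fun φ hφ x hx ↦ ?_)) fun x hx ↦ ?_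
  · exact mem_heightFiltration_of_mem (χ := 0) (n := 0) (by simp) (mem_rootSpace_zero_iff.mpr hx)
  · obtain ⟨n, hn⟩ := Int.eq_ofNat_of_zero_le (le_of_lt hφ)
    refine mem_heightFiltration_of_mem (n := n) ?_ hx
    rw [root_heightCoweight, hn]
    simp
  · refine heightFiltration_induction (p := (· ∈ _)) (fun χ n hn x hx ↦ ?_) (zero_mem _)
      (fun _ _ ↦ add_mem) hx
    rcases eq_or_ne x 0 with rfl | hx0
    · exact zero_mem _
    rcases eq_zero_or_root_of_mem_rootSpace hx hx0 with rfl | ⟨α, rfl⟩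
    · exact le_standardBorel b (mem_rootSpace_zero_iff.mp hx)
    · refine rootSpace_le_standardBorel (b.isPos_iff'.mpr ?_) hx
      rw [root_heightCoweight] at hn
      have : b.height α = n := by exact_mod_cast hn
      omega

/-- The standard Borel subalgebra, as a Lie subalgebra. -/
noncomputable def standardBorelSubalgebra : LieSubalgebra ℂ L :=
  { standardBorel b with
    lie_mem' := fun {x y} hx hy ↦ by
      change x ∈ standardBorel b at hx
      change y ∈ standardBorel b at hy
      change ⁅x, y⁆ ∈ standardBorel b
      rw [standardBorel_eq_heightFiltration] at *
      exact lie_mem_heightFiltration (k := 0) (l := 0) hx hy }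

lemma isSolvable_standardBorelSubalgebra : IsSolvable (standardBorelSubalgebra b) := by
  obtain ⟨k, hk⟩ := exists_heightFiltration_eq_bot (b := b)
  have h0 (x : standardBorelSubalgebra b) : (x : L) ∈ heightFiltration b 0 := by
    rw [← standardBorel_eq_heightFiltration]
    exact x.2
  have key (n : ℕ) : ∀ x ∈ derivedSeries ℂ (standardBorelSubalgebra b) n,
      (x : L) ∈ heightFiltration b n := by
    induction n with
    | zero => exact fun x _ ↦ h0 x
    | succ n ih =>
      intro x hx
      rw [derivedSeries_def, derivedSeriesOfIdeal_succ, ← derivedSeries_def,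
        ← LieSubmodule.mem_toSubmodule, LieSubmodule.lieIdeal_oper_eq_linear_span'] at hx
      induction hx using Submodule.span_induction with
      | zero => exact zero_mem _
      | add x y _ _ hx hy => exact add_mem hx hy
      | smul c x _ hx => exact Submodule.smul_mem _ c hx
      | mem x hx =>
        obtain ⟨y, hy, z, hz, rfl⟩ := hx
        rw [LieSubalgebra.coe_bracket]
        -- Bracketing level `n` with itself lands in level `2n`, which is at least `n + 1` only for
        -- positive `n`; the first step needs the commutativity of `H`.
        rcases Nat.eq_zero_or_pos n with rfl | hn
        · exact lie_mem_heightFiltration_one (h0 y) (h0 z)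
        · exact heightFiltration_anti (by omega) (lie_mem_heightFiltration (ih y hy) (ih z hz))
  refine IsSolvable.mk (R := ℂ) (k := k) ((LieSubmodule.eq_bot_iff _).mpr fun x hx ↦ Subtype.ext ?_)
  have := key k x hx
  rwa [hk] at this

lemma isPos_or_rootSpace_neg_le (α : H.root) :
    b.IsPos α ∨ (rootSpace H (-α.1 : H → ℂ)).toSubmodule ≤ standardBorel b := by
  let := (rootSystem H).indexNeg
  refine (RootPairing.Base.IsPos.or_neg b α).imp_right fun h ↦ ?_
  rw [← neg_coe_root]
  exact rootSpace_le_standardBorel h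

variable {b}

/-- If `α` were negative, `C` would contain the root spaces of both `α` and `-α`, hence an
`sl₂`-triple. -/
lemma isPos_of_isSolvable {C : LieSubalgebra ℂ L} (hC : IsSolvable C)
    (hb : standardBorel b ≤ C.toSubmodule) {α : H.root} {x : L} (hx : x ∈ rootSpace H α.1)
    (hx0 : x ≠ 0) (hxC : x ∈ C) : b.IsPos α :=
  (isPos_or_rootSpace_neg_le b α).resolve_right fun h ↦
    not_isSolvable_of_rootSpace_le (rootSpace_le_of_mem hx hx0 hxC) (h.trans hb) hC

lemma isPos_of_mem_standardBorel {α : H.root} {x : L} (hx : x ∈ rootSpace H α.1)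
    (hx0 : x ≠ 0) (hxb : x ∈ standardBorel b) : b.IsPos α :=
  isPos_of_isSolvable (isSolvable_standardBorelSubalgebra b) le_rfl hx hx0 hxb

lemma isPos_iff_rootSpace_le_standardBorel {α : H.root} :
    b.IsPos α ↔ (rootSpace H α.1).toSubmodule ≤ standardBorel b := by
  refine ⟨rootSpace_le_standardBorel, fun h ↦ ?_⟩
  obtain ⟨x, hx, hx0⟩ := α.1.exists_ne_zero
  exact isPos_of_mem_standardBorel hx hx0 (h hx)

variable (b) in
theorem isBorel_standardBorelSubalgebra : IsBorel (standardBorelSubalgebra b) := by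
  refine ⟨isSolvable_standardBorelSubalgebra b, fun C hC hb ↦ ?_⟩
  refine le_of_forall_mem_rootSpace (H := H) (N := C.toSubmodule) (M := standardBorel b)
    (fun h hh x hx ↦ C.lie_mem (hb (le_standardBorel b hh)) hx)
    (fun x _ hx ↦ le_standardBorel b hx) fun α x hxC hx ↦ ?_
  rcases eq_or_ne x 0 with rfl | hx0
  · exact zero_mem _
  · exact rootSpace_le_standardBorel (isPos_of_isSolvable hC hb hx hx0 hxC) hx

end BorelDeSiebenthal

/-! ### Subalgebras that contain a Cartan subalgebra -/

namespace LieAlgebra.IsKilling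

open LieModule

variable {𝔤 : Type*} [LieRing 𝔤] [LieAlgebra ℂ 𝔤] [FiniteDimensional ℂ 𝔤] [IsKilling ℂ 𝔤]
  {H : LieSubalgebra ℂ 𝔤} [H.IsCartanSubalgebra] {K : LieSubalgebra ℂ 𝔤}

/-- An element of `K` that normalizes `H` inside `K` already normalizes it in `𝔤`, because `H` lies
in `K`. -/
lemma isCartanSubalgebra_comap_incl (hHK : H ≤ K) : (H.comap K.incl).IsCartanSubalgebra := by
  have : IsLieAbelian (H.comap K.incl) := by
    refine ⟨fun x y ↦ Subtype.ext (Subtype.ext ?_)⟩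
    have h : ⁅(⟨x.1, x.2⟩ : H), (⟨y.1, y.2⟩ : H)⁆ = 0 := trivial_lie_zero H H _ _
    have h' := congrArg Subtype.val h
    exact h'
  refine ⟨inferInstance, le_antisymm (fun x hx ↦ ?_) (LieSubalgebra.le_normalizer _)⟩
  rw [LieSubalgebra.mem_normalizer_iff] at hx
  change (x : 𝔤) ∈ H
  rw [← LieSubalgebra.IsCartanSubalgebra.self_normalizing (H := H), LieSubalgebra.mem_normalizer_iff]
  exact fun y hy ↦ hx ⟨y, hHK hy⟩ hy

/-- A subalgebra that contains a Cartan subalgebra is semisimple if its set of roots is symmetric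
and the common kernel of these roots is trivial. -/
lemma isKilling_of_forall_root (hHK : H ≤ K)
    (hneg : ∀ α : H.root, (rootSpace H α.1).toSubmodule ≤ K.toSubmodule →
      (rootSpace H (-α.1 : H → ℂ)).toSubmodule ≤ K.toSubmodule)
    (hker : ∀ h : H, (∀ α : H.root, (rootSpace H α.1).toSubmodule ≤ K.toSubmodule → α.1 h = 0) →
      h = 0) : IsKilling ℂ K := by
  suffices HasTrivialRadical ℂ K from inferInstance
  rw [hasTrivialRadical_iff_no_abelian_ideals]
  intro I hI
  let A : Submodule ℂ 𝔤 := I.toSubmodule.map K.toSubmodule.subtype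
  have hA {x : 𝔤} (hx : x ∈ A) : x ∈ K := by
    obtain ⟨y, -, rfl⟩ := hx
    exact y.2
  have hlie {x y : 𝔤} (hx : x ∈ K) (hy : y ∈ A) : ⁅x, y⁆ ∈ A := by
    obtain ⟨y, hy, rfl⟩ := hy
    exact ⟨⁅⟨x, hx⟩, y⁆, lie_mem_right ℂ K I _ _ hy, rfl⟩
  have hab {x y : 𝔤} (hx : x ∈ A) (hy : y ∈ A) : ⁅x, y⁆ = 0 := by
    obtain ⟨x, hx, rfl⟩ := hx
    obtain ⟨y, hy, rfl⟩ := hy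
    exact congrArg (fun z : I ↦ ((z : K) : 𝔤)) (trivial_lie_zero I I ⟨x, hx⟩ ⟨y, hy⟩)
  -- A root vector `e` in the abelian ideal would bring `h = [e, f]` into it, but `[h, e] = 2e` is
  -- nonzero.
  have hroot (α : H.root) (x : 𝔤) (hxA : x ∈ A) (hx : x ∈ rootSpace H α.1) : x = 0 := by
    by_contra hx0
    have hαA := rootSpace_le_of_mem hx hx0 hxA
    obtain ⟨h, e, f, t, he, hf⟩ := exists_isSl2Triple_of_weight_isNonZero (H.isNonZero_coe_root α)
    have hfK : f ∈ K := hneg α (fun y hy ↦ hA (hαA hy)) hf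
    have hhA : h ∈ A := by
      rw [← t.lie_e_f, ← lie_skew]
      exact neg_mem (hlie hfK (hαA he))
    have h2 := hab hhA (hαA he)
    rw [t.lie_h_e_smul ℂ] at h2
    exact t.e_ne_zero ((smul_eq_zero.mp h2).resolve_left two_ne_zero)
  have hbot : A ≤ ⊥ := by
    refine le_of_forall_mem_rootSpace (H := H) (fun h hh x hx ↦ hlie (hHK hh) hx)
      (fun x hxA hxH ↦ ?_) hroot
    -- For `x` in both the ideal and `H`, the vector `[x, e] = α(x) e` is a root vector in the
    -- ideal, so it vanishes and `α(x) = 0`.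
    have := hker ⟨x, hxH⟩ fun α hα ↦ ?_
    · exact congrArg Subtype.val this
    · obtain ⟨e, he, he0⟩ := α.1.exists_ne_zero
      have h1 : ⁅x, e⁆ = α.1 ⟨x, hxH⟩ • e := lie_eq_smul_of_mem_rootSpace he ⟨x, hxH⟩
      have h2 : ⁅x, e⁆ ∈ A := by
        rw [← lie_skew]
        exact neg_mem (hlie (hα he) hxA)
      rw [h1] at h2
      have h3 := hroot α _ h2 (SMulMemClass.smul_mem _ he)
      exact (smul_eq_zero.mp h3).resolve_right he0
  refine (LieSubmodule.eq_bot_iff _).mpr fun x hx ↦ Subtype.ext ?_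
  exact hbot ⟨x, hx, rfl⟩

/-- A subalgebra `H` of `𝔤` contained in `K` is linearly equivalent to the corresponding subalgebra
of `K`. -/
def comapInclEquiv (hHK : H ≤ K) : H.comap K.incl ≃ₗ[ℂ] H where
  toFun h := ⟨h.1, h.2⟩
  map_add' _ _ := rfl
  map_smul' _ _ := rfl
  invFun h := ⟨⟨h, hHK h.2⟩, h.2⟩
  left_inv _ := rfl
  right_inv _ := rfl

variable [IsKilling ℂ K] [(H.comap K.incl).IsCartanSubalgebra]

lemma mem_rootSpace_comap_incl_iff (hHK : H ≤ K) {χ : H → ℂ} {x : K} :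
    x ∈ rootSpace (H.comap K.incl) (χ ∘ comapInclEquiv hHK) ↔ (x : 𝔤) ∈ rootSpace H χ := by
  rw [mem_rootSpace_iff, mem_rootSpace_iff]
  refine ⟨fun h y ↦ congrArg Subtype.val (h ((comapInclEquiv hHK).symm y)), fun h y ↦ ?_⟩
  exact Subtype.ext (h (comapInclEquiv hHK y))

lemma exists_root_of_comap_incl (hHK : H ≤ K) (β : (H.comap K.incl).root) :
    ∃ α : H.root, (rootSpace H α.1).toSubmodule ≤ K.toSubmodule ∧
      (β.1 : H.comap K.incl → ℂ) = (α.1 : H → ℂ) ∘ comapInclEquiv hHK := by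
  have hβ : (β.1 : H.comap K.incl → ℂ) =
      ((β.1 : H.comap K.incl → ℂ) ∘ (comapInclEquiv hHK).symm) ∘ comapInclEquiv hHK := by
    ext; simp
  obtain ⟨x, hx, hx0⟩ := β.1.exists_ne_zero
  rw [hβ, mem_rootSpace_comap_incl_iff] at hx
  rcases eq_zero_or_root_of_mem_rootSpace hx (by simpa using hx0) with h | ⟨α, h⟩
  · rw [h] at hβ
    exact absurd hβ (LieSubalgebra.isNonZero_coe_root β)
  · rw [h] at hβ hx
    exact ⟨α, rootSpace_le_of_mem hx (by simpa using hx0) x.2, hβ⟩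

lemma exists_root_comap_incl (hHK : H ≤ K) {α : H.root} {x : 𝔤} (hx : x ∈ rootSpace H α.1)
    (hx0 : x ≠ 0) (hxK : x ∈ K) : ∃ β : (H.comap K.incl).root,
      (β.1 : H.comap K.incl → ℂ) = (α.1 : H → ℂ) ∘ comapInclEquiv hHK := by
  have hx' := (mem_rootSpace_comap_incl_iff hHK (x := ⟨x, hxK⟩)).mpr hx
  rcases eq_zero_or_root_of_mem_rootSpace hx' (fun h ↦ hx0 (congrArg Subtype.val h)) with h | ⟨β, h⟩
  · refine absurd ?_ (H.isNonZero_coe_root α)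
    ext y
    simpa using congrFun h ((comapInclEquiv hHK).symm y)
  · exact ⟨β, h.symm⟩

/-- The coroot is the middle element of an `sl₂`-triple of root vectors, and such a triple in `K` is
also one in `𝔤`. -/
lemma comapInclEquiv_coroot (hHK : H ≤ K) {β : (H.comap K.incl).root} {α : H.root}
    (hβ : (β.1 : H.comap K.incl → ℂ) = (α.1 : H → ℂ) ∘ comapInclEquiv hHK) :
    comapInclEquiv hHK (coroot β.1) = coroot α.1 := by
  obtain ⟨h, e, f, t, he, hf⟩ := exists_isSl2Triple_of_weight_isNonZero
    (LieSubalgebra.isNonZero_coe_root β)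
  have hh := t.h_eq_coroot (LieSubalgebra.isNonZero_coe_root β) he hf
  have hβ' : (-β.1 : H.comap K.incl → ℂ) = (-α.1 : H → ℂ) ∘ comapInclEquiv hHK := by
    rw [hβ]; rfl
  rw [hβ, mem_rootSpace_comap_incl_iff] at he
  rw [hβ', mem_rootSpace_comap_incl_iff] at hf
  have t' : IsSl2Triple (h : 𝔤) e f :=
    ⟨fun h0 ↦ t.h_ne_zero (Subtype.ext h0), congrArg Subtype.val t.lie_e_f,
      congrArg Subtype.val t.lie_h_e_nsmul, congrArg Subtype.val t.lie_h_f_nsmul⟩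
  have hh' := t'.h_eq_coroot (H.isNonZero_coe_root α) he hf
  exact Subtype.ext ((congrArg Subtype.val hh).symm.trans hh')

lemma pairingIn_comap_incl (hHK : H ≤ K) {β₁ β₂ : (H.comap K.incl).root} {α₁ α₂ : H.root}
    (h₁ : (β₁.1 : H.comap K.incl → ℂ) = (α₁.1 : H → ℂ) ∘ comapInclEquiv hHK)
    (h₂ : (β₂.1 : H.comap K.incl → ℂ) = (α₂.1 : H → ℂ) ∘ comapInclEquiv hHK) :
    (rootSystem (H.comap K.incl)).pairingIn ℤ β₁ β₂ = (rootSystem H).pairingIn ℤ α₁ α₂ := by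
  apply FaithfulSMul.algebraMap_injective ℤ ℂ
  rw [RootPairing.algebraMap_pairingIn, RootPairing.algebraMap_pairingIn, rootSystem_pairing_apply,
    rootSystem_pairing_apply, h₁, Function.comp_apply, comapInclEquiv_coroot hHK h₂]

end LieAlgebra.IsKilling

namespace BorelDeSiebenthal

open LieAlgebra.IsKilling

/-! ### Combinatorics of the highest root -/

section HighestRoot

variable {ι M N : Type*} [AddCommGroup M] [Module ℂ M] [AddCommGroup N] [Module ℂ N]
  {P : RootPairing ι ℂ M N} {b : P.Base} {ψ : ι}

/-- Maximality applied to `-φ`. With the original property it bounds the coefficients of `φ` from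
both sides. -/
lemma IsHighestRoot.add_mem_closure (hψ : IsHighestRoot b ψ) (φ : ι) :
    P.root ψ + P.root φ ∈ AddSubmonoid.closure (P.root '' b.support) := by
  have := hψ (P.reflectionPerm φ φ)
  rwa [P.root_reflectionPerm, P.reflection_apply_self, sub_neg_eq_add] at this

/-- The index of the root `nodeRoot b ψ ν`. -/
def nodeIndex (b : P.Base) (ψ : ι) : Option b.support → ι
  | some i => i
  | none => P.reflectionPerm ψ ψ

lemma root_nodeIndex (ν : Option b.support) : P.root (nodeIndex b ψ ν) = nodeRoot b ψ ν := by
  cases ν with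
  | none => rw [nodeIndex, nodeRoot, P.root_reflectionPerm, P.reflection_apply_self]
  | some i => rfl

lemma lines_self [P.IsCrystallographic] (ν : Option b.support) :
    (extendedDynkinDiagram b ψ).lines ν ν = 0 := by
  cases ν <;> simp [extendedDynkinDiagram, dynkinDiagram]

variable [P.IsRootSystem]

/-- Maximality against `α_i` itself makes the coefficient at least one. -/
lemma IsHighestRoot.exists_coeff_eq_natCast (hψ : IsHighestRoot b ψ) (i : b.support) :
    ∃ n : ℕ, 0 < n ∧ coeff b ψ i = n := by
  obtain ⟨n, hn⟩ := b.exists_repr_eq_natCast_of_mem_closure (hψ i) i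
  refine ⟨n + 1, n.succ_pos, ?_⟩
  rw [map_sub, Finsupp.sub_apply, RootPairing.Base.toWeightBasis_repr_root, Finsupp.single_eq_same,
    sub_eq_iff_eq_add] at hn
  rw [coeff, hn]
  simp

lemma IsHighestRoot.coeff_ne_zero (hψ : IsHighestRoot b ψ) (i : b.support) : coeff b ψ i ≠ 0 := by
  obtain ⟨n, hn, h⟩ := hψ.exists_coeff_eq_natCast i
  rw [h]
  exact_mod_cast hn.ne'

lemma IsHighestRoot.coeff_eq_of_coeff_eq_intCast_mul (hψ : IsHighestRoot b ψ) {φ : ι}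
    {i : b.support} {m : ℤ} (h : coeff b φ i = m * coeff b ψ i) :
    coeff b φ i = 0 ∨ coeff b φ i = coeff b ψ i ∨ coeff b φ i = -coeff b ψ i := by
  obtain ⟨n, hn, hn'⟩ := hψ.exists_coeff_eq_natCast i
  obtain ⟨k, hk⟩ := b.exists_repr_eq_natCast_of_mem_closure (hψ φ) i
  obtain ⟨l, hl⟩ := b.exists_repr_eq_natCast_of_mem_closure (hψ.add_mem_closure φ) i
  rw [map_sub, Finsupp.sub_apply] at hk
  rw [map_add, Finsupp.add_apply] at hl
  change coeff b ψ i - coeff b φ i = k at hk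
  change coeff b ψ i + coeff b φ i = l at hl
  rw [h, hn'] at hk hl
  have hk' : (n : ℤ) - m * n = k := by exact_mod_cast hk
  have hl' : (n : ℤ) + m * n = l := by exact_mod_cast hl
  have h1 : m ≤ 1 := by
    by_contra! hm
    nlinarith
  have h2 : -1 ≤ m := by
    by_contra! hm
    nlinarith
  rw [h]
  interval_cases m <;> simp

/-- The nodes of the extended Dynkin diagram other than `αⱼ`. -/
abbrev RemainingNode (j : b.support) : Type _ := {ν : Option b.support // ν ≠ some j}

lemma root_mem_closure_nodeRoot_of_coeff_eq_zero {x : M}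
    (hx : x ∈ AddSubmonoid.closure (P.root '' b.support)) {j : b.support}
    (hj : b.toWeightBasis.repr x j = 0) :
    x ∈ AddSubmonoid.closure (Set.range fun ν : RemainingNode j ↦ nodeRoot b ψ ν) := by
  refine b.mem_closure_of_forall_repr hx fun i ↦ ?_
  by_cases hi : i = j
  · exact Or.inl (hi ▸ hj)
  · exact Or.inr ⟨⟨some i, by simpa using hi⟩, rfl⟩

lemma IsHighestRoot.root_mem_closure_nodeRoot_of_coeff_eq_neg (hψ : IsHighestRoot b ψ) {φ : ι}
    {j : b.support} (hj : coeff b φ j = -coeff b ψ j) :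
    P.root φ ∈ AddSubmonoid.closure (Set.range fun ν : RemainingNode j ↦ nodeRoot b ψ ν) := by
  have h1 := root_mem_closure_nodeRoot_of_coeff_eq_zero (ψ := ψ) (j := j) (hψ.add_mem_closure φ) (by
    rw [map_add, Finsupp.add_apply]
    change coeff b ψ j + coeff b φ j = 0
    rw [hj, add_neg_cancel])
  have h2 : -P.root ψ ∈ AddSubmonoid.closure (Set.range fun ν : RemainingNode j ↦ nodeRoot b ψ ν) :=
    AddSubmonoid.subset_closure ⟨⟨none, by simp⟩, rfl⟩
  have := add_mem h1 h2
  rwa [add_comm (P.root ψ), add_neg_cancel_right] at this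

lemma exists_eq_sub_of_mem_closure_nodeRoot {x : M} {j : b.support}
    (hx : x ∈ AddSubmonoid.closure (Set.range fun ν : RemainingNode j ↦ nodeRoot b ψ ν)) :
    ∃ m : ℕ, ∃ y ∈ AddSubmonoid.closure (P.root '' b.support),
      b.toWeightBasis.repr y j = 0 ∧ x = y - m • P.root ψ := by
  induction hx using AddSubmonoid.closure_induction with
  | zero => exact ⟨0, 0, zero_mem _, by simp, by simp⟩
  | add x₁ x₂ _ _ h₁ h₂ =>
    obtain ⟨m₁, y₁, hy₁, hj₁, rfl⟩ := h₁
    obtain ⟨m₂, y₂, hy₂, hj₂, rfl⟩ := h₂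
    refine ⟨m₁ + m₂, y₁ + y₂, add_mem hy₁ hy₂, by simp [hj₁, hj₂], ?_⟩
    rw [add_smul]
    abel
  | mem x hx =>
    obtain ⟨⟨ν, hν⟩, rfl⟩ := hx
    cases ν with
    | none => exact ⟨1, 0, zero_mem _, by simp, by simp [nodeRoot]⟩
    | some i =>
      refine ⟨0, P.root i, AddSubmonoid.subset_closure ⟨i, i.2, rfl⟩, ?_, by simp [nodeRoot]⟩
      rw [RootPairing.Base.toWeightBasis_repr_root, Finsupp.single_eq_of_ne]
      rintro rfl
      exact hν rfl

/-- Write the root as `y - mψ` with `y` free of `α_j` and compare `α_j`-coefficients: the value `0`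
forces `m = 0`, and the value `n_j(ψ)` would force `m = -1`. -/
lemma IsHighestRoot.coeff_of_root_mem_closure_nodeRoot (hψ : IsHighestRoot b ψ) {φ : ι}
    {j : b.support}
    (hφ : coeff b φ j = 0 ∨ coeff b φ j = coeff b ψ j ∨ coeff b φ j = -coeff b ψ j)
    (h : P.root φ ∈ AddSubmonoid.closure (Set.range fun ν : RemainingNode j ↦ nodeRoot b ψ ν)) :
    coeff b φ j = 0 ∧ P.root φ ∈ AddSubmonoid.closure (P.root '' b.support) ∨
      coeff b φ j = -coeff b ψ j := by
  obtain ⟨m, y, hy, hj, hm⟩ := exists_eq_sub_of_mem_closure_nodeRoot h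
  have hc : coeff b φ j = -(m * coeff b ψ j) := by
    rw [coeff, hm, map_sub, Finsupp.sub_apply, hj, map_nsmul, Finsupp.smul_apply, zero_sub,
      nsmul_eq_mul]
    rfl
  have hn := hψ.coeff_ne_zero j
  rcases hφ with h0 | h1 | h1
  · left
    rw [h0, zero_eq_neg, mul_eq_zero, Nat.cast_eq_zero] at hc
    rw [hc.resolve_right hn, zero_smul, sub_zero] at hm
    exact ⟨h0, hm ▸ hy⟩
  · have : ((m + 1 : ℕ) : ℂ) * coeff b ψ j = 0 := by
      push_cast
      linear_combination hc - h1
    simp [hn, Nat.cast_add_one_ne_zero] at this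
  · exact Or.inr h1

/-- Among the remaining nodes only `-ψ` has an `α_j`-coordinate, and it is nonzero. So the
coefficient of `-ψ` vanishes, and the rest is the independence of simple roots. -/
lemma IsHighestRoot.linearIndependent_nodeRoot (hψ : IsHighestRoot b ψ) (j : b.support) :
    LinearIndependent ℂ fun ν : RemainingNode j ↦ nodeRoot b ψ ν := by
  classical
  rw [Fintype.linearIndependent_iff]
  intro g hg
  have hc (i : b.support) :
      ∑ ν : RemainingNode j, g ν * b.toWeightBasis.coord i (nodeRoot b ψ ν) = 0 := by
    simpa using congrArg (b.toWeightBasis.coord i) hg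
  have hsome (i k : b.support) :
      b.toWeightBasis.coord i (nodeRoot b ψ (some k)) = if k = i then 1 else 0 := by
    rw [nodeRoot, Module.Basis.coord_apply, RootPairing.Base.toWeightBasis_repr_root,
      Finsupp.single_apply]
  have h0 : g ⟨none, by simp⟩ = 0 := by
    have := hc j
    rw [Finset.sum_eq_single ⟨none, by simp⟩] at this
    · refine (mul_eq_zero.mp this).resolve_right ?_
      simpa [nodeRoot, coeff] using hψ.coeff_ne_zero j
    · rintro ⟨ν, hν⟩ - hν'
      cases ν with
      | none => exact absurd rfl hν'
      | some k =>
        change g _ * b.toWeightBasis.coord j (nodeRoot b ψ (some k)) = 0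
        rw [hsome, if_neg (by rintro rfl; exact hν rfl), mul_zero]
    · simp
  rintro ⟨ν, hν⟩
  cases ν with
  | none => exact h0
  | some i =>
    have := hc i
    rw [Finset.sum_eq_single ⟨some i, hν⟩] at this
    · change g _ * b.toWeightBasis.coord i (nodeRoot b ψ (some i)) = 0 at this
      simpa [hsome] using this
    · rintro ⟨μ, hμ⟩ - hμ'
      cases μ with
      | none => rw [h0, zero_mul]
      | some k =>
        change g _ * b.toWeightBasis.coord i (nodeRoot b ψ (some k)) = 0
        rw [hsome, if_neg (by rintro rfl; exact hμ' rfl), mul_zero]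
    · simp

variable [P.IsCrystallographic]

/-- Subtracting from `ψ` its reflection in `α_i` leaves `⟨ψ, α_i^∨⟩ α_i`, a sum of simple roots by
maximality. -/
lemma IsHighestRoot.pairingIn_nonneg (hψ : IsHighestRoot b ψ) (i : b.support) :
    0 ≤ P.pairingIn ℤ ψ i := by
  obtain ⟨n, hn⟩ := b.exists_repr_eq_natCast_of_mem_closure (hψ (P.reflectionPerm i ψ)) i
  rw [P.root_reflectionPerm, P.reflection_apply_root' ℤ, sub_sub_cancel, map_zsmul,
    Finsupp.smul_apply, RootPairing.Base.toWeightBasis_repr_root, Finsupp.single_eq_same,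
    zsmul_one] at hn
  have : P.pairingIn ℤ ψ i = n := by exact_mod_cast hn
  omega

/-- The second simple root `α_j` serves as a witness: in `ψ + s_ψ(α_i)` its coefficient is `n_j(ψ)
(1 - ⟨α_i, ψ^∨⟩)`, which cannot be negative. -/
lemma IsHighestRoot.pairingIn_le_one (hψ : IsHighestRoot b ψ) {i j : b.support} (hij : i ≠ j) :
    P.pairingIn ℤ i ψ ≤ 1 := by
  obtain ⟨n, hn, hn'⟩ := hψ.exists_coeff_eq_natCast j
  obtain ⟨m, hm⟩ := b.exists_repr_eq_natCast_of_mem_closure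
    (hψ.add_mem_closure (P.reflectionPerm ψ i)) j
  rw [P.root_reflectionPerm, P.reflection_apply_root' ℤ, map_add, map_sub, map_zsmul,
    RootPairing.Base.toWeightBasis_repr_root, Finsupp.add_apply, Finsupp.sub_apply,
    Finsupp.smul_apply, Finsupp.single_eq_of_ne hij.symm, zero_sub] at hm
  change coeff b ψ j + -(P.pairingIn ℤ i ψ • coeff b ψ j) = m at hm
  rw [hn', zsmul_eq_mul] at hm
  have : (n : ℤ) + -(P.pairingIn ℤ i ψ * n) = m := by exact_mod_cast hm
  by_contra! h
  nlinarith

variable [Finite ι]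

lemma IsHighestRoot.pairingIn_eq_or (hψ : IsHighestRoot b ψ) {i j : b.support} (hij : i ≠ j) :
    P.pairingIn ℤ ψ i = 0 ∧ P.pairingIn ℤ i ψ = 0 ∨
      0 < P.pairingIn ℤ ψ i ∧ P.pairingIn ℤ i ψ = 1 := by
  rcases (hψ.pairingIn_nonneg i).eq_or_lt with h | h
  · exact Or.inl ⟨h.symm, P.pairingIn_eq_zero_iff.mp h.symm⟩
  · have h1 := hψ.pairingIn_le_one hij
    have h2 : 0 < P.pairingIn ℤ i ψ := (P.zero_lt_pairingIn_iff' ℤ).mp h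
    exact Or.inr ⟨h, by omega⟩

/-- Replacing `ψ` by `-ψ` changes the sign of both Cartan integers and so keeps their product, which
is `m_i` because `⟨α_i, ψ^∨⟩` is `1` whenever it is nonzero. -/
lemma IsHighestRoot.lines_eq (hψ : IsHighestRoot b ψ) {j : b.support} {ν μ : Option b.support}
    (hν : ν ≠ some j) (hμ : μ ≠ some j) (h : ν ≠ μ) :
    (extendedDynkinDiagram b ψ).lines ν μ = (P.pairingIn ℤ (nodeIndex b ψ ν) (nodeIndex b ψ μ) *
      P.pairingIn ℤ (nodeIndex b ψ μ) (nodeIndex b ψ ν)).toNat := by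
  cases ν <;> cases μ
  · exact absurd rfl h
  · rename_i i
    have hi : i ≠ j := fun h ↦ hμ (congrArg some h)
    simp only [extendedDynkinDiagram, nodeIndex, P.pairingIn_reflectionPerm_self_left,
      P.pairingIn_reflectionPerm_self_right]
    rcases hψ.pairingIn_eq_or hi with ⟨h1, h2⟩ | ⟨h1, h2⟩ <;> simp [h1, h2]
  · rename_i i
    have hi : i ≠ j := fun h ↦ hν (congrArg some h)
    simp only [extendedDynkinDiagram, nodeIndex, P.pairingIn_reflectionPerm_self_left,
      P.pairingIn_reflectionPerm_self_right]
    rcases hψ.pairingIn_eq_or hi with ⟨h1, h2⟩ | ⟨h1, h2⟩ <;> simp [h1, h2]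
  · rename_i i k
    have hik : i ≠ k := fun h' ↦ h (congrArg some h')
    simp [extendedDynkinDiagram, dynkinDiagram, nodeIndex, hik]

lemma IsHighestRoot.arrow_iff (hψ : IsHighestRoot b ψ) {j : b.support} {ν μ : Option b.support}
    (hν : ν ≠ some j) (hμ : μ ≠ some j) :
    (extendedDynkinDiagram b ψ).arrow ν μ ↔ |P.pairingIn ℤ (nodeIndex b ψ μ) (nodeIndex b ψ ν)| <
      |P.pairingIn ℤ (nodeIndex b ψ ν) (nodeIndex b ψ μ)| := by
  cases ν <;> cases μ
  · simp [extendedDynkinDiagram]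
  · rename_i i
    have hi : i ≠ j := fun h ↦ hμ (congrArg some h)
    simp only [extendedDynkinDiagram, nodeIndex, P.pairingIn_reflectionPerm_self_left,
      P.pairingIn_reflectionPerm_self_right]
    rcases hψ.pairingIn_eq_or hi with ⟨h1, h2⟩ | ⟨h1, h2⟩
    · simp [h1, h2]
    · simp [h2, abs_of_pos h1]
  · rename_i i
    have hi : i ≠ j := fun h ↦ hν (congrArg some h)
    simp only [extendedDynkinDiagram, nodeIndex, P.pairingIn_reflectionPerm_self_left,
      P.pairingIn_reflectionPerm_self_right]
    rcases hψ.pairingIn_eq_or hi with ⟨h1, h2⟩ | ⟨h1, h2⟩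
    · simp [h1, h2]
    -- An arrowhead at the extra node would need `⟨ψ, α_i^∨⟩ < 1`, but this integer is positive
    -- here.
    · simp only [h2, abs_neg, abs_of_pos h1, abs_one, false_iff, not_lt]
      omega
  · rfl

end HighestRoot

end BorelDeSiebenthal

/-! ### The centralizer of an alcove vertex -/

namespace BorelDeSiebenthal

open LieAlgebra LieAlgebra.IsKilling LieModule

variable {𝔤 : Type*} [LieRing 𝔤] [LieAlgebra ℂ 𝔤] [FiniteDimensional ℂ 𝔤] [IsKilling ℂ 𝔤]
  {H : LieSubalgebra ℂ 𝔤} [H.IsCartanSubalgebra] {b : (rootSystem H).Base} {ψ : H.root}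
  {j : b.support}

lemma root_fundCoweight (α : H.root) (j : b.support) : α.1 (fundCoweight b j) = coeff b α j := by
  have : (rootSystem H).root α (fundCoweight b j) = coeff b α j := by
    rw [fundCoweight, Module.apply_evalEquiv_symm_apply]
    rfl
  exact this

lemma mem_gradedPart_iff_of_mem_rootSpace {α : H.root} {x : 𝔤} (hx : x ∈ rootSpace H α.1)
    (hx0 : x ≠ 0) {k : ℂ} : x ∈ gradedPart b j k ↔ coeff b α j = k := by
  have h : ⁅(fundCoweight b j : 𝔤), x⁆ = coeff b α j • x := by
    rw [← root_fundCoweight]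
    exact lie_eq_smul_of_mem_rootSpace hx _
  rw [gradedPart, Module.End.mem_eigenspace_iff, LieAlgebra.ad_apply, h]
  exact (smul_left_injective ℂ hx0).eq_iff

lemma lie_coe_eq_zero {x y : 𝔤} (hx : x ∈ H) (hy : y ∈ H) : ⁅x, y⁆ = 0 := by
  have h := trivial_lie_zero H H ⟨x, hx⟩ ⟨y, hy⟩
  exact congrArg Subtype.val h

lemma le_gradedPart_zero : H.toSubmodule ≤ gradedPart b j 0 := fun x hx ↦ by
  rw [gradedPart, Module.End.mem_eigenspace_iff, LieAlgebra.ad_apply, zero_smul]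
  exact lie_coe_eq_zero (fundCoweight b j).2 hx

lemma lie_mem_gradedPart {h x : 𝔤} (hh : h ∈ H) {k : ℂ} (hx : x ∈ gradedPart b j k) :
    ⁅h, x⁆ ∈ gradedPart b j k := by
  rw [gradedPart, Module.End.mem_eigenspace_iff, LieAlgebra.ad_apply] at hx ⊢
  rw [leibniz_lie, lie_coe_eq_zero (fundCoweight b j).2 hh, zero_lie, zero_add, hx, lie_smul]

lemma mem_vertexCentralizer_iff {x : 𝔤} : x ∈ vertexCentralizer b ψ j ↔
    expEnd (ad ℂ 𝔤 ((2 * Real.pi * Complex.I) • (alcoveVertex b ψ j : 𝔤))) x = x := Iff.rfl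

lemma le_vertexCentralizer : H ≤ vertexCentralizer b ψ j := fun x hx ↦ by
  rw [mem_vertexCentralizer_iff, expEnd_apply_of_eigenvector _ 0, Complex.exp_zero, one_smul]
  rw [LieAlgebra.ad_apply, smul_lie, lie_coe_eq_zero (alcoveVertex b ψ j).2 hx, smul_zero, zero_smul]

lemma mem_vertexCentralizer_iff_of_mem_rootSpace (hψ : IsHighestRoot b ψ) {α : H.root} {x : 𝔤}
    (hx : x ∈ rootSpace H α.1) (hx0 : x ≠ 0) : x ∈ vertexCentralizer b ψ j ↔
      coeff b α j = 0 ∨ coeff b α j = coeff b ψ j ∨ coeff b α j = -coeff b ψ j := by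
  have hn := hψ.coeff_ne_zero j
  have hv : α.1 (alcoveVertex b ψ j) = (coeff b ψ j)⁻¹ * coeff b α j := by
    rw [← root_fundCoweight α]
    exact map_smul (α.1 : Weight ℂ H 𝔤).toLinear _ _
  rw [mem_vertexCentralizer_iff, expEnd_apply_of_eigenvector _
    ((2 * Real.pi * Complex.I) * ((coeff b ψ j)⁻¹ * coeff b α j))]
  · have h1 (c : ℂ) : c • x = x ↔ c = 1 := by
      simpa using (smul_left_injective ℂ hx0).eq_iff (a := c) (b := 1)
    rw [h1, Complex.exp_eq_one_iff]
    -- The eigenvalue is `1` exactly when `n_j(α)` is an integer multiple of `n_j(ψ)`, and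
    -- maximality leaves only the multiples `0` and `±1`.
    refine ⟨fun ⟨m, hm⟩ ↦ hψ.coeff_eq_of_coeff_eq_intCast_mul (m := m) ?_, fun h ↦ ?_⟩
    · have := mul_left_cancel₀ Complex.two_pi_I_ne_zero (hm.trans (mul_comm _ _))
      rw [← this]
      field_simp
    · rcases h with h | h | h
      · exact ⟨0, by simp [h]⟩
      · exact ⟨1, by simp [h, hn]⟩
      · exact ⟨-1, by simp [h, hn]⟩
  · have h : ⁅(alcoveVertex b ψ j : 𝔤), x⁆ = α.1 (alcoveVertex b ψ j) • x :=
      lie_eq_smul_of_mem_rootSpace hx _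
    rw [LieAlgebra.ad_apply, smul_lie, h, hv, smul_smul]

lemma coeff_reflectionPerm_self (α : H.root) :
    coeff b ((rootSystem H).reflectionPerm α α) j = -coeff b α j := by
  rw [coeff, RootPairing.root_reflectionPerm, RootPairing.reflection_apply_self, map_neg,
    Finsupp.neg_apply]
  rfl

lemma coeff_of_mem_support {i : b.support} (hi : i ≠ j) : coeff b i j = 0 := by
  rw [coeff, RootPairing.Base.toWeightBasis_repr_root, Finsupp.single_eq_of_ne hi.symm]

lemma rootSpace_le_vertexCentralizer_iff (hψ : IsHighestRoot b ψ) {α : H.root} :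
    (rootSpace H α.1).toSubmodule ≤ (vertexCentralizer b ψ j).toSubmodule ↔
      coeff b α j = 0 ∨ coeff b α j = coeff b ψ j ∨ coeff b α j = -coeff b ψ j := by
  obtain ⟨x, hx, hx0⟩ := α.1.exists_ne_zero
  rw [← mem_vertexCentralizer_iff_of_mem_rootSpace hψ hx hx0]
  exact ⟨fun h ↦ h hx, fun h ↦ rootSpace_le_of_mem hx hx0 h⟩

theorem isKilling_vertexCentralizer (hψ : IsHighestRoot b ψ) :
    IsKilling ℂ (vertexCentralizer b ψ j) := by
  refine isKilling_of_forall_root (H := H) le_vertexCentralizer (fun α hα ↦ ?_) fun h hh ↦ ?_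
  · rw [← neg_coe_root]
    rw [rootSpace_le_vertexCentralizer_iff hψ] at hα ⊢
    rw [coeff_reflectionPerm_self]
    rcases hα with h | h | h <;> simp [h]
  · have h1 (i : b.support) (hi : i ≠ j) : (rootSystem H).root i h = 0 :=
      hh i ((rootSpace_le_vertexCentralizer_iff hψ).mpr (Or.inl (coeff_of_mem_support hi)))
    have h2 : (rootSystem H).root ψ h = 0 :=
      hh ψ ((rootSpace_le_vertexCentralizer_iff hψ).mpr (Or.inr (Or.inl rfl)))
    -- In the expansion of `ψ(h) = 0` only the `α_j`-term is left, and its coefficient is nonzero.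
    have h3 : (rootSystem H).root j h = 0 := by
      rw [← b.toWeightBasis.sum_repr ((rootSystem H).root ψ), LinearMap.sum_apply,
        Finset.sum_eq_single j (fun i _ hi ↦ by
          rw [LinearMap.smul_apply, RootPairing.Base.toWeightBasis_apply, h1 i hi, smul_zero])
        (by simp),
        LinearMap.smul_apply, RootPairing.Base.toWeightBasis_apply, smul_eq_mul] at h2
      exact (mul_eq_zero.mp h2).resolve_left (hψ.coeff_ne_zero j)
    have h4 : Module.Dual.eval ℂ H h = 0 := by
      refine b.toWeightBasis.ext fun i ↦ ?_
      rw [RootPairing.Base.toWeightBasis_apply]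
      by_cases hi : i = j
      · exact hi ▸ h3
      · exact h1 i hi
    exact (Module.forall_dual_apply_eq_zero_iff ℂ h).mp fun f ↦ LinearMap.congr_fun h4 f

lemma root_mem_closure_nodeRoot_or_neg (hψ : IsHighestRoot b ψ) {α : H.root}
    (hα : coeff b α j = 0 ∨ coeff b α j = coeff b ψ j ∨ coeff b α j = -coeff b ψ j) :
    (rootSystem H).root α ∈
        AddSubmonoid.closure (Set.range fun ν : RemainingNode j ↦ nodeRoot b ψ ν) ∨
      -(rootSystem H).root α ∈
        AddSubmonoid.closure (Set.range fun ν : RemainingNode j ↦ nodeRoot b ψ ν) := by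
  rcases hα with h | h | h
  · refine (b.root_mem_or_neg_mem α).imp (fun h' ↦ ?_) fun h' ↦ ?_
    · exact root_mem_closure_nodeRoot_of_coeff_eq_zero h' h
    · refine root_mem_closure_nodeRoot_of_coeff_eq_zero h' ?_
      rw [map_neg, Finsupp.neg_apply, neg_eq_zero]
      exact h
  · right
    have := hψ.root_mem_closure_nodeRoot_of_coeff_eq_neg
      (φ := (rootSystem H).reflectionPerm α α) (by rw [coeff_reflectionPerm_self, h])
    rwa [RootPairing.root_reflectionPerm, RootPairing.reflection_apply_self] at this
  · exact Or.inl (hψ.root_mem_closure_nodeRoot_of_coeff_eq_neg h)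

lemma coeff_nodeIndex (ν : RemainingNode j) :
    coeff b (nodeIndex b ψ ν) j = 0 ∨ coeff b (nodeIndex b ψ ν) j = coeff b ψ j ∨
      coeff b (nodeIndex b ψ ν) j = -coeff b ψ j := by
  obtain ⟨ν, hν⟩ := ν
  cases ν with
  | none => exact Or.inr (Or.inr (coeff_reflectionPerm_self ψ))
  | some i => exact Or.inl (coeff_of_mem_support fun h ↦ hν (congrArg some h))

section Transfer

variable {K : LieSubalgebra ℂ 𝔤} (hHK : H ≤ K) [IsKilling ℂ K]
  [(H.comap K.incl).IsCartanSubalgebra]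

lemma root_eq_dualMap {β : (H.comap K.incl).root} {α : H.root}
    (h : (β.1 : H.comap K.incl → ℂ) = (α.1 : H → ℂ) ∘ comapInclEquiv hHK) :
    (rootSystem (H.comap K.incl)).root β = (comapInclEquiv hHK).dualMap ((rootSystem H).root α) :=
  LinearMap.ext (congrFun h)

end Transfer

lemma dualMap_mem_closure_iff {V W ν : Type*} [AddCommGroup V] [Module ℂ V] [AddCommGroup W]
    [Module ℂ W] (D : V ≃ₗ[ℂ] W) {u : ν → V} {v : ν → W} (h : ∀ i, v i = D (u i)) {x : V} :
    D x ∈ AddSubmonoid.closure (Set.range v) ↔ x ∈ AddSubmonoid.closure (Set.range u) := by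
  have hr : Set.range v = (D.toAddEquiv : V →+ W) '' Set.range u := by
    rw [← Set.range_comp]
    exact congrArg Set.range (funext h)
  rw [hr, ← AddMonoidHom.map_mclosure]
  exact AddSubmonoid.mem_map_iff_mem (f := (D.toAddEquiv : V →+ W)) D.injective

/-- The simple roots of the centralizer of a vertex of the fundamental alcove. -/
theorem exists_base_vertexCentralizer (hψ : IsHighestRoot b ψ)
    [IsKilling ℂ (vertexCentralizer b ψ j)]
    [(H.comap (vertexCentralizer b ψ j).incl).IsCartanSubalgebra] :
    ∃ (b' : (rootSystem (H.comap (vertexCentralizer b ψ j).incl)).Base)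
      (e : b'.support ≃ RemainingNode j),
      (∀ i : b'.support, (i.1.1 : H.comap (vertexCentralizer b ψ j).incl → ℂ) =
        ((nodeIndex b ψ (e i)).1 : H → ℂ) ∘ comapInclEquiv le_vertexCentralizer) ∧
      ∀ (β : (H.comap (vertexCentralizer b ψ j).incl).root) (α : H.root),
        (β.1 : H.comap (vertexCentralizer b ψ j).incl → ℂ) =
          (α.1 : H → ℂ) ∘ comapInclEquiv le_vertexCentralizer →
        (b'.IsPos β ↔ (rootSystem H).root α ∈
          AddSubmonoid.closure (Set.range fun ν : RemainingNode j ↦ nodeRoot b ψ ν)) := by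
  have hHK : H ≤ vertexCentralizer b ψ j := le_vertexCentralizer
  have hex (ν : RemainingNode j) : ∃ β : (H.comap (vertexCentralizer b ψ j).incl).root,
      (β.1 : H.comap (vertexCentralizer b ψ j).incl → ℂ) =
        ((nodeIndex b ψ ν).1 : H → ℂ) ∘ comapInclEquiv hHK := by
    obtain ⟨x, hx, hx0⟩ := (nodeIndex b ψ ν).1.exists_ne_zero
    exact exists_root_comap_incl hHK hx hx0
      ((mem_vertexCentralizer_iff_of_mem_rootSpace hψ hx hx0).mpr (coeff_nodeIndex ν))
  choose f hf using hex
  have hroot (ν : RemainingNode j) :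
      ((rootSystem (H.comap (vertexCentralizer b ψ j).incl)).root ∘ f) ν =
      (comapInclEquiv hHK).dualMap (nodeRoot b ψ ν) := by
    rw [← root_nodeIndex]
    exact root_eq_dualMap hHK (hf ν)
  have hli : LinearIndependent ℂ ((rootSystem (H.comap (vertexCentralizer b ψ j).incl)).root ∘ f) := by
    rw [funext hroot]
    exact (hψ.linearIndependent_nodeRoot j).map' (comapInclEquiv hHK).dualMap.toLinearMap
      (LinearEquiv.ker _)
  have hcl {x : Module.Dual ℂ H} :=
    dualMap_mem_closure_iff (comapInclEquiv hHK).dualMap hroot (x := x)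
  obtain ⟨b', e, he⟩ := RootPairing.Base.exists_of_linearIndependent_of_mem_or_neg_mem _ f hli
    fun β ↦ by
      obtain ⟨α, hα, hβ⟩ := exists_root_of_comap_incl hHK β
      rw [root_eq_dualMap hHK hβ, ← map_neg, hcl, hcl]
      exact root_mem_closure_nodeRoot_or_neg hψ ((rootSpace_le_vertexCentralizer_iff hψ).mp hα)
  refine ⟨b', e, fun i ↦ by rw [← he i, hf], fun β α hβ ↦ ?_⟩
  have hr : (rootSystem (H.comap (vertexCentralizer b ψ j).incl)).root '' b'.support =
      Set.range ((rootSystem (H.comap (vertexCentralizer b ψ j).incl)).root ∘ f) := by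
    ext x
    constructor
    · rintro ⟨i, hi, rfl⟩
      exact ⟨e ⟨i, hi⟩, by rw [Function.comp_apply, he]⟩
    · rintro ⟨ν, rfl⟩
      refine ⟨e.symm ν, (e.symm ν).2, ?_⟩
      rw [← he, Equiv.apply_symm_apply, Function.comp_apply]
  rw [RootPairing.Base.isPos_iff_mem_closure, hr, root_eq_dualMap hHK hβ, hcl]

/-- All the subspaces involved contain `H` or are stable under it, so it is enough to compare root
vectors. Positive roots for `b'` with `n_j = 0` match `𝔪[j] ∩ 𝔟`, and those with `n_j = -n_j(ψ)`
match the lowest graded part. -/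
theorem map_standardBorel_eq_vertexBorel (hψ : IsHighestRoot b ψ)
    [IsKilling ℂ (vertexCentralizer b ψ j)]
    [(H.comap (vertexCentralizer b ψ j).incl).IsCartanSubalgebra]
    {b' : (rootSystem (H.comap (vertexCentralizer b ψ j).incl)).Base}
    (hb' : ∀ (β : (H.comap (vertexCentralizer b ψ j).incl).root) (α : H.root),
      (β.1 : H.comap (vertexCentralizer b ψ j).incl → ℂ) =
        (α.1 : H → ℂ) ∘ comapInclEquiv le_vertexCentralizer →
      (b'.IsPos β ↔ (rootSystem H).root α ∈
        AddSubmonoid.closure (Set.range fun ν : RemainingNode j ↦ nodeRoot b ψ ν))) :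
    (standardBorel b').map (vertexCentralizer b ψ j).toSubmodule.subtype = vertexBorel b ψ j := by
  have hHK : H ≤ vertexCentralizer b ψ j := le_vertexCentralizer
  have hH {x : 𝔤} (hx : x ∈ H) :
      x ∈ (standardBorel b').map (vertexCentralizer b ψ j).toSubmodule.subtype :=
    ⟨⟨x, hHK hx⟩,
      le_standardBorel b' (show (⟨x, hHK hx⟩ : vertexCentralizer b ψ j) ∈ _ from hx), rfl⟩
  have hroot {α : H.root} {x : 𝔤} (hx : x ∈ rootSpace H α.1) (hx0 : x ≠ 0)
      (hα : coeff b α j = 0 ∨ coeff b α j = coeff b ψ j ∨ coeff b α j = -coeff b ψ j)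
      (hcl : (rootSystem H).root α ∈
        AddSubmonoid.closure (Set.range fun ν : RemainingNode j ↦ nodeRoot b ψ ν)) :
      x ∈ (standardBorel b').map (vertexCentralizer b ψ j).toSubmodule.subtype := by
    have hxK := (mem_vertexCentralizer_iff_of_mem_rootSpace hψ hx hx0).mpr hα
    obtain ⟨β, hβ⟩ := exists_root_comap_incl hHK hx hx0 hxK
    refine ⟨⟨x, hxK⟩, rootSpace_le_standardBorel ((hb' β α hβ).mpr hcl) ?_, rfl⟩
    rw [LieSubmodule.mem_toSubmodule, hβ]
    exact (mem_rootSpace_comap_incl_iff hHK).mpr hx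
  refine le_antisymm ?_ (sup_le ?_ ?_)
  · rw [standardBorel, Submodule.map_sup, Submodule.map_iSup]
    refine sup_le ?_ (iSup_le fun β ↦ ?_)
    · rintro _ ⟨x, hx, rfl⟩
      exact Submodule.mem_sup_left ⟨le_gradedPart_zero hx, le_standardBorel b hx⟩
    · rw [Submodule.map_iSup]
      refine iSup_le fun hβ ↦ ?_
      rintro _ ⟨x, hx, rfl⟩
      obtain ⟨α, hα, hβα⟩ := exists_root_of_comap_incl hHK β
      rw [SetLike.mem_coe, LieSubmodule.mem_toSubmodule, hβα, mem_rootSpace_comap_incl_iff] at hx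
      rcases eq_or_ne (x : 𝔤) 0 with h0 | h0
      · rw [Submodule.subtype_apply, h0]
        exact zero_mem _
      rcases hψ.coeff_of_root_mem_closure_nodeRoot
        ((rootSpace_le_vertexCentralizer_iff hψ).mp hα) ((hb' β α hβα).mp hβ) with ⟨h, hp⟩ | h
      · exact Submodule.mem_sup_left ⟨(mem_gradedPart_iff_of_mem_rootSpace hx h0).mpr h,
          rootSpace_le_standardBorel ((b.isPos_iff_mem_closure α).mpr hp) hx⟩
      · exact Submodule.mem_sup_right ((mem_gradedPart_iff_of_mem_rootSpace hx h0).mpr h)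
  · refine le_of_forall_mem_rootSpace (H := H) (fun h hh x hx ↦ ?_) (fun x _ ↦ hH) ?_
    · exact ⟨lie_mem_gradedPart hh hx.1,
        (standardBorelSubalgebra b).lie_mem (le_standardBorel b hh) hx.2⟩
    · rintro α x ⟨hx0, hxb⟩ hx
      rcases eq_or_ne x 0 with rfl | h0
      · exact zero_mem _
      have hc := (mem_gradedPart_iff_of_mem_rootSpace hx h0).mp hx0
      exact hroot hx h0 (Or.inl hc) (root_mem_closure_nodeRoot_of_coeff_eq_zero
        ((b.isPos_iff_mem_closure α).mp (isPos_of_mem_standardBorel hx h0 hxb)) hc)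
  · refine le_of_forall_mem_rootSpace (H := H) (fun h hh x ↦ lie_mem_gradedPart hh) (fun x _ ↦ hH) ?_
    intro α x hxn hx
    rcases eq_or_ne x 0 with rfl | h0
    · exact zero_mem _
    have hc := (mem_gradedPart_iff_of_mem_rootSpace hx h0).mp hxn
    exact hroot hx h0 (Or.inr (Or.inr hc)) (hψ.root_mem_closure_nodeRoot_of_coeff_eq_neg hc)

end BorelDeSiebenthal

/-! ### The theorem -/

open LieAlgebra LieAlgebra.IsKilling BorelDeSiebenthal in
theorem theorem3p7 {𝔤 : Type*} [LieRing 𝔤] [LieAlgebra ℂ 𝔤] [FiniteDimensional ℂ 𝔤]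
    [IsSimple ℂ 𝔤] (H : LieSubalgebra ℂ 𝔤) [H.IsCartanSubalgebra]
    (b : (rootSystem H).Base) (ψ : H.root) (hψ : IsHighestRoot b ψ) (j : b.support) :
    H ≤ vertexCentralizer b ψ j ∧
    ∃ (_ : IsKilling ℂ (vertexCentralizer b ψ j))
      (_ : (H.comap (vertexCentralizer b ψ j).incl).IsCartanSubalgebra)
      (b' : (rootSystem (H.comap (vertexCentralizer b ψ j).incl)).Base)
      (e : (dynkinDiagram b').Iso ((extendedDynkinDiagram b ψ).deleteNode (some j))),
      (∀ (i : b'.support) (h : H.comap (vertexCentralizer b ψ j).incl),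
        (rootSystem (H.comap (vertexCentralizer b ψ j).incl)).root i h =
          nodeRoot b ψ (e.nodes i) ⟨h.1, h.2⟩) ∧
      ∃ B : LieSubalgebra ℂ (vertexCentralizer b ψ j),
        IsBorel B ∧
        B.toSubmodule.map (vertexCentralizer b ψ j).toSubmodule.subtype = vertexBorel b ψ j ∧
        ∀ φ : (H.comap (vertexCentralizer b ψ j).incl).root,
          b'.IsPos φ ↔
            (rootSpace (H.comap (vertexCentralizer b ψ j).incl) φ.1).toSubmodule ≤
              B.toSubmodule := by
  have hK := isKilling_vertexCentralizer (j := j) hψ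
  have hC := isCartanSubalgebra_comap_incl (le_vertexCentralizer (b := b) (ψ := ψ) (j := j))
  obtain ⟨b', e, he, hpos⟩ := exists_base_vertexCentralizer (j := j) hψ
  refine ⟨le_vertexCentralizer, hK, hC, b', ⟨e, fun i k ↦ ?_, fun i k ↦ ?_⟩, fun i h ↦ ?_,
    standardBorelSubalgebra b', isBorel_standardBorelSubalgebra b',
    map_standardBorel_eq_vertexBorel hψ hpos, fun φ ↦ isPos_iff_rootSpace_le_standardBorel⟩
  · by_cases hik : i = k
    · subst hik
      simp only [DynkinDiagram.deleteNode, lines_self, dynkinDiagram, if_true]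
    · have hne : (e i : Option b.support) ≠ e k := fun h ↦ hik (e.injective (Subtype.ext h))
      simp only [DynkinDiagram.deleteNode, hψ.lines_eq (e i).2 (e k).2 hne, dynkinDiagram,
        if_neg hik,
        pairingIn_comap_incl le_vertexCentralizer (he i) (he k),
        pairingIn_comap_incl le_vertexCentralizer (he k) (he i)]
  · simp only [DynkinDiagram.deleteNode, hψ.arrow_iff (e i).2 (e k).2, dynkinDiagram,
        pairingIn_comap_incl le_vertexCentralizer (he i) (he k),
        pairingIn_comap_incl le_vertexCentralizer (he k) (he i)]
  · rw [← root_nodeIndex]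
    exact congrFun (he i) h
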